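/- Let $d\ge 2$ and $n\ge 1$ be integers, let $c,t>0$, and let $\mathbf a=(a_1,\dots,a_n)$, $\mathbf b=(b_1,\dots,b_n)$ have positive entries. The generalized Dirichlet distribution $GD(\mathbf a;\mathbf b)$ is the probability distribution on the open simplex $S_n=\{\tau\in\mathbb R^n: 0<\tau_k<t-\sum_{j<k}\tau_j,\ 1\le k\le n\}$ with density $$C\prod_{k=1}^n \tau_k^{a_k-1}\Big(t-\sum_{j=1}^k\tau_j\Big)^{b_k-1},\qquad C=\frac{1}{t^{\sum_{k=1}^n(a_k+b_k-1)}}\prod_{k=1}^n\frac{\Gamma\big(1+\sum_{j=k}^n(a_j+b_j-1)\big)}{\Gamma(a_k)\,\Gamma\big(b_k+\sum_{j=k+1}^n(a_j+b_j-1)\big)} .$$ The random walk with parameters $(\mathbf a,\mathbf b)$ and $n$ changes of direction up to time $t$ has position $c\sum_{k=1}^{n+1}\tau_k V_k$ at time $t$, where $(\tau_1,\dots,\tau_n)\sim GD(\mathbf a;\mathbf b)$, $\tau_{n+1}=t-\sum_{k=1}^n\tau_k$, and $V_1,\dots,V_{n+1}$ are uniformly distributed on the unit sphere of $\mathbb R^d$,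 independent of each other and of $(\tau_1,\dots,\tau_n)$. Let $h\in\{1,2\}$, with $d\ge 3$ if $h=2$, and let $j\ge 1$ be an integer. All walks below have $\mathbf a=(\frac dh-1,\dots,\frac dh-1)$. For $i\in\{0,1\}$ let $Y_d^{h,i}$ be the walk with $\mathbf b=(1,\dots,1,\frac dh-i)$. Let $Z_d^{h,j}$ be the walk with $b_n=\frac dh-1$, with $b_j=2$ if $j<n$, and with all other $b_k$ equal to $1$ (so $\mathbf b=(1,\dots,1,\frac dh-1)$ if $j\ge n$). **Theorem.** For all such $d,n,h,j,c,t$, the positions at time $t$ of the walks $Y_d^{h,0}$, $Y_d^{h,1}$ and $Z_d^{h,j}$, each with $n$ changes of direction, are identically distributed. Their common characteristic function at $\alpha\in\mathbb R^d$ is, for $h=1$, $$\frac{2^{\frac{n+1}{2}(d-1)-\frac12}\,\Gamma\big(\frac{n+1}{2}(d-1)+\frac12\big)}{(ct\|\alpha\|)^{\frac{n+1}{2}(d-1)-\frac12}}\,J_{\frac{n+1}{2}(d-1)-\frac12}(ct\|\alpha\|),$$ and for $h=2$, $$\frac{2^{(n+1)(\frac d2-1)}\,\Gamma\big((n+1)(\frac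 d2-1)+1\big)}{(ct\|\alpha\|)^{(n+1)(\frac d2-1)}}\,J_{(n+1)(\frac d2-1)}(ct\|\alpha\|),$$ where $J_\nu(x)=\sum_{k\ge0}\frac{(-1)^k}{k!\,\Gamma(k+\nu+1)}\left(\frac x2\right)^{2k+\nu}$ and both expressions are read as their limit $1$ at $\alpha=0$. -/

import Mathlib

open MeasureTheory ProbabilityTheory
open scoped BigOperators

noncomputable section

/-- Bessel function of the first kind of real order `ν`, for nonnegative real arguments. -/
def besselJ (ν x : ℝ) : ℝ :=
  ∑' k : ℕ, (-1 : ℝ) ^ k * (x / 2) ^ (2 * (k : ℝ) + ν) *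
    (1 / ((k.factorial : ℝ) * Real.Gamma ((k : ℝ) + ν + 1)))

/-- The open simplex of the vectors `(τ₁, …, τₙ)` with
`0 < τ_k < t - ∑_{j < k} τ_j` for every `k`. -/
def timeSimplex (n : ℕ) (t : ℝ) : Set (Fin n → ℝ) :=
  {τ | ∀ k, 0 < τ k ∧ τ k < t - ∑ j ∈ Finset.Iio k, τ j}

/-- The normalizing constant of the generalized Dirichlet density. -/
def gdConst {n : ℕ} (a b : Fin n → ℝ) (t : ℝ) : ℝ :=
  1 / t ^ (∑ k, (a k + b k - 1)) *
    ∏ k, Real.Gamma (1 + ∑ j ∈ Finset.Ici k, (a j + b j - 1)) /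
      (Real.Gamma (a k) * Real.Gamma (b k + ∑ j ∈ Finset.Ioi k, (a j + b j - 1)))

/-- The (rescaled) generalized Dirichlet density with parameters `a` and `b`. -/
def gdDensity {n : ℕ} (a b : Fin n → ℝ) (t : ℝ) (τ : Fin n → ℝ) : ℝ :=
  gdConst a b t * ∏ k, (τ k ^ (a k - 1) * (t - ∑ j ∈ Finset.Iic k, τ j) ^ (b k - 1))

/-- The (rescaled) generalized Dirichlet distribution `GD(a; b)` on the simplex. -/
def gdMeasure {n : ℕ} (a b : Fin n → ℝ) (t : ℝ) : Measure (Fin n → ℝ) :=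
  (volume.restrict (timeSimplex n t)).withDensity fun τ => ENNReal.ofReal (gdDensity a b t τ)

/-- The uniform distribution on the unit sphere of `ℝᵈ`: the surface measure, normalized. -/
def uniformSphere (d : ℕ) : Measure (Metric.sphere (0 : EuclideanSpace ℝ (Fin d)) 1) :=
  ((volume : Measure (EuclideanSpace ℝ (Fin d))).toSphere Set.univ)⁻¹ •
    (volume : Measure (EuclideanSpace ℝ (Fin d))).toSphere

/-- The sample space of a walk with `n + 1` steps in `ℝᵈ`: the first `n` time intervals and
the `n + 1` directions. -/
abbrev WalkSpace (d n : ℕ) : Type :=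
  (Fin n → ℝ) × (Fin (n + 1) → Metric.sphere (0 : EuclideanSpace ℝ (Fin d)) 1)

/-- The joint law of the time intervals, with distribution `GD(a; b)`, and of the directions,
which are uniform on the sphere, independent of each other and of the time intervals. -/
def walkMeasure (d : ℕ) {n : ℕ} (a b : Fin n → ℝ) (t : ℝ) : Measure (WalkSpace d n) :=
  (gdMeasure a b t).prod (Measure.pi fun _ => uniformSphere d)

/-- All the `n + 1` time intervals `τ₁, …, τₙ, τₙ₊₁ = t - (τ₁ + ⋯ + τₙ)`. -/
def stepTimes {n : ℕ} (t : ℝ) (τ : Fin n → ℝ) : Fin (n + 1) → ℝ :=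
  Fin.snoc τ (t - ∑ k, τ k)

/-- The position at time `t` of the walk with speed `c`. -/
def walkPosition {d n : ℕ} (c t : ℝ) (ω : WalkSpace d n) : EuclideanSpace ℝ (Fin d) :=
  c • ∑ k, stepTimes t ω.1 k • (ω.2 k : EuclideanSpace ℝ (Fin d))

/-- The parameters `(d/h - 1, …, d/h - 1)`. -/
def paramA (d n h : ℕ) : Fin n → ℝ := fun _ => (d : ℝ) / h - 1

/-- The parameters `(1, …, 1, d/h - i)` of the walk `Y^{h,i}`. -/
def paramBY (d n h i : ℕ) : Fin n → ℝ := fun k =>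
  if (k : ℕ) + 1 = n then (d : ℝ) / h - i else 1

/-- The parameters of the switching-phase walk `Z^{h,j}`: the last entry is `d/h - 1`, the `j`-th
entry is `2` if `j < n`, and all other entries are `1` (entries are numbered from one). -/
def paramBZ (d n h j : ℕ) : Fin n → ℝ := fun k =>
  if (k : ℕ) + 1 = n then (d : ℝ) / h - 1 else if (k : ℕ) + 1 = j then 2 else 1

/-- The law of `Y^{h,i}` on the sample space, given that there are `n` changes of direction
up to time `t`. -/
def measureY (d n h i : ℕ) (t : ℝ) : Measure (WalkSpace d n) :=
  walkMeasure d (paramA d n h) (paramBY d n h i) t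

/-- The law of `Z^{h,j}` on the sample space, given that there are `n` changes of direction
up to time `t`. -/
def measureZ (d n h j : ℕ) (t : ℝ) : Measure (WalkSpace d n) :=
  walkMeasure d (paramA d n h) (paramBZ d n h j) t

/-- The Bessel-type expression for `h = 1`, extended by continuity to `α = 0`. -/
def besselCF1 (d n : ℕ) (c t : ℝ) (α : EuclideanSpace ℝ (Fin d)) : ℝ :=
  if α = 0 then 1 else
    2 ^ (((n : ℝ) + 1) / 2 * ((d : ℝ) - 1) - 1 / 2) *
        Real.Gamma (((n : ℝ) + 1) / 2 * ((d : ℝ) - 1) + 1 / 2) /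
      (c * t * ‖α‖) ^ (((n : ℝ) + 1) / 2 * ((d : ℝ) - 1) - 1 / 2) *
      besselJ (((n : ℝ) + 1) / 2 * ((d : ℝ) - 1) - 1 / 2) (c * t * ‖α‖)

/-- The Bessel-type expression for `h = 2`, extended by continuity to `α = 0`. -/
def besselCF2 (d n : ℕ) (c t : ℝ) (α : EuclideanSpace ℝ (Fin d)) : ℝ :=
  if α = 0 then 1 else
    2 ^ (((n : ℝ) + 1) * ((d : ℝ) / 2 - 1)) *
        Real.Gamma (((n : ℝ) + 1) * ((d : ℝ) / 2 - 1) + 1) /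
      (c * t * ‖α‖) ^ (((n : ℝ) + 1) * ((d : ℝ) / 2 - 1)) *
      besselJ (((n : ℝ) + 1) * ((d : ℝ) / 2 - 1)) (c * t * ‖α‖)

end

/-! Put `p = d/h - 1`. In all three families `b` equals `(1, …, 1, p) + ε`, where `ε` has entries in
`{0, 1}` and at most one entry equal to 1. Up to a constant the density of the times is therefore `∏
τ_k^(p-1)` over all `n + 1` intervals, times at most one linear factor `t - ∑_{j ≤ k} τ_j`. The
claim is that this linear factor does not affect the law of the position.

Given the times, the characteristic function of the position is a product of sphere characteristic
functions `φ_p(c‖α‖τ_k)`, where `φ_p` denotes the normalized Bessel function of order `besselOrder h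
p = d/2 - 1` (`charFun_walkPosition`, `integral_cexp_inner_uniformSphere`). Integrating out the
times is an iterated convolution, and one convolution step is `∫₀ᵗ s^(p-1) φ_p(ls) (t-s)^(q+e-1)
φ_q(l(t-s)) ds = const · t^(p+q+e-1) φ_{p+q}(lt)`, with `e = 0` or `1`
(`integral_normBessel_mul_normBessel`). The exponent `e` enters the constant and the power of `t`,
but not the Bessel factor. By induction the result is a constant times a power of `t` times
`φ_{(n+1)p}(lt)`; since everything is a probability measure (`GDAdmissible.lintegral_gdWeight`),
evaluation at `l = 0` shows that the prefactor becomes 1 after normalization.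

The convolution step is a statement about power series. The Beta integral attaches `Γ(2i+p)` to the
`i`-th Bessel coefficient, and exactly for `h = 1, 2` the product is, up to a geometric factor, a
Rothe coefficient `x/(x+hi) · C(x+hi, i)` at `x = hp/2`; with `Γ(2i+p+1)` it is `C(x+hi, i)` instead
(`besselCoeff_mul_Gamma`, `besselCoeff_mul_Gamma_add_one`). The cases `e = 0` and `e = 1` are then
the two Rothe–Hagen convolution identities, both contained in `sum_rothe_mul`. -/

open Finset.HasAntidiagonal (antidiagonal)

noncomputable section

/-! ### Rothe–Hagen convolution identities -/

/-- Real functions given by a polynomial. -/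
def IsPolynomialFun (f : ℝ → ℝ) : Prop := ∃ P : Polynomial ℝ, ∀ x, f x = P.eval x

namespace IsPolynomialFun

theorem const (c : ℝ) : IsPolynomialFun fun _ => c := ⟨Polynomial.C c, by simp⟩

theorem add {f g : ℝ → ℝ} (hf : IsPolynomialFun f) (hg : IsPolynomialFun g) :
    IsPolynomialFun fun x => f x + g x := by
  obtain ⟨P, hP⟩ := hf
  obtain ⟨Q, hQ⟩ := hg
  exact ⟨P + Q, by simp [hP, hQ]⟩

theorem mul {f g : ℝ → ℝ} (hf : IsPolynomialFun f) (hg : IsPolynomialFun g) :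
    IsPolynomialFun fun x => f x * g x := by
  obtain ⟨P, hP⟩ := hf
  obtain ⟨Q, hQ⟩ := hg
  exact ⟨P * Q, by simp [hP, hQ]⟩

theorem comp_add_const {f : ℝ → ℝ} (hf : IsPolynomialFun f) (c : ℝ) :
    IsPolynomialFun fun x => f (x + c) := by
  obtain ⟨P, hP⟩ := hf
  exact ⟨P.comp (Polynomial.X + Polynomial.C c), by simp [hP]⟩

theorem sum {ι : Type*} (s : Finset ι) {f : ι → ℝ → ℝ} (hf : ∀ i, IsPolynomialFun (f i)) :
    IsPolynomialFun fun x => ∑ i ∈ s, f i x := by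
  choose P hP using hf
  exact ⟨∑ i ∈ s, P i, by simp [hP, Polynomial.eval_finsetSum]⟩

theorem choose (k : ℕ) : IsPolynomialFun fun x => Ring.choose x k :=
  ⟨Polynomial.C ((k.factorial : ℝ)⁻¹) * descPochhammer ℝ k, fun x => by
    simp [Ring.choose_eq_smul, ← Polynomial.aeval_eq_smeval, Polynomial.aeval_def, Polynomial.eval₂_eq_eval_map,
      descPochhammer_map]⟩

theorem eq_of_forall_nat {f g : ℝ → ℝ} (hf : IsPolynomialFun f) (hg : IsPolynomialFun g)
    (h : ∀ m : ℕ, f m = g m) (x : ℝ) : f x = g x := by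
  obtain ⟨P, hP⟩ := hf
  obtain ⟨Q, hQ⟩ := hg
  have hPQ : P = Q := by
    refine Polynomial.eq_of_infinite_eval_eq P Q ?_
    refine (Set.infinite_range_of_injective (Nat.cast_injective (R := ℝ))).mono ?_
    rintro _ ⟨m, rfl⟩
    simp [← hP, ← hQ, h m]
  rw [hP, hQ, hPQ]

end IsPolynomialFun

/-- The binomial coefficient `C(x + z k, k)`. -/
def shiftedChoose (z : ℝ) (k : ℕ) (x : ℝ) : ℝ := Ring.choose (x + z * k) k

/-- The Rothe coefficient `x / (x + z k) * C(x + z k, k)`, as a polynomial in `x`. -/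
def rothe (z : ℝ) : ℕ → ℝ → ℝ
  | 0, _ => 1
  | k + 1, x => shiftedChoose z (k + 1) x - z * shiftedChoose z k (x + (z - 1))

theorem rothe_zero (z x : ℝ) : rothe z 0 x = 1 := rfl

theorem isPolynomialFun_shiftedChoose (z : ℝ) (k : ℕ) : IsPolynomialFun (shiftedChoose z k) :=
  (IsPolynomialFun.choose k).comp_add_const _

theorem isPolynomialFun_rothe (z : ℝ) (k : ℕ) : IsPolynomialFun (rothe z k) := by
  cases k with
  | zero => exact IsPolynomialFun.const 1
  | succ k =>
    obtain ⟨P, hP⟩ := (isPolynomialFun_shiftedChoose z (k + 1)).add ((IsPolynomialFun.const (-z)).mul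
      ((isPolynomialFun_shiftedChoose z k).comp_add_const (z - 1)))
    exact ⟨P, fun x => by rw [← hP, rothe]; ring⟩

theorem shiftedChoose_add_one (z : ℝ) (k : ℕ) (x : ℝ) :
    shiftedChoose z (k + 1) (x + 1) = shiftedChoose z (k + 1) x + shiftedChoose z k (x + z) := by
  have h := Ring.choose_succ_succ (x + z * (k + 1 : ℕ)) k
  simp only [shiftedChoose]
  rw [show x + 1 + z * ((k + 1 : ℕ) : ℝ) = x + z * ((k + 1 : ℕ) : ℝ) + 1 by ring, h, add_comm]
  congr 2
  push_cast
  ring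

theorem rothe_add_one (z : ℝ) (k : ℕ) (x : ℝ) :
    rothe z (k + 1) (x + 1) = rothe z (k + 1) x + rothe z k (x + z) := by
  cases k with
  | zero => simp [rothe, shiftedChoose]
  | succ k =>
    simp only [rothe]
    rw [shiftedChoose_add_one, show x + 1 + (z - 1) = x + (z - 1) + 1 by ring,
      shiftedChoose_add_one, show x + z + (z - 1) = x + (z - 1) + z by ring]
    ring

/-- Absorption `(k+1) C(w, k+1) = w C(w-1, k)` at `w = z(k+1)` makes the two terms cancel. This
starts the induction on the argument in `sum_rothe_mul`. -/
theorem rothe_zero_right (z : ℝ) (k : ℕ) : rothe z (k + 1) 0 = 0 := by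
  have h := Ring.choose_smul_choose (z * ((k : ℝ) + 1)) (n := k + 1) (k := 1) (by omega)
  simp only [Nat.choose_one_right, Ring.choose_one_right, Nat.add_sub_cancel, nsmul_eq_mul] at h
  have hk : ((k : ℝ) + 1) ≠ 0 := by positivity
  simp only [rothe, shiftedChoose]
  push_cast at h ⊢
  rw [zero_add, zero_add, show z - 1 + z * (k : ℝ) = z * ((k : ℝ) + 1) - 1 by ring]
  refine mul_left_cancel₀ hk ?_
  rw [mul_sub, h]
  ring

/-- Rothe coefficients and shifted binomials satisfy the same difference equation, a form of
Pascal's rule. In `x`, both sides of the identity inherit it and agree at `x = 0`, so they agree at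
all natural `x`, and hence everywhere by polynomiality. Keeping `f` abstract yields both Rothe–Hagen
identities at once. -/
theorem sum_rothe_mul {z : ℝ} {f : ℕ → ℝ → ℝ}
    (hf0 : ∀ x y, f 0 x = f 0 y)
    (hf : ∀ k x, f (k + 1) (x + 1) = f (k + 1) x + f k (x + z))
    (hpoly : ∀ k, IsPolynomialFun (f k)) (n : ℕ) (x y : ℝ) :
    ∑ ij ∈ antidiagonal n, rothe z ij.1 x * f ij.2 y = f n (x + y) := by
  induction n generalizing x y with
  | zero => simp [rothe, hf0 y (x + y)]
  | succ n ih =>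
    refine IsPolynomialFun.eq_of_forall_nat
      (f := fun x => ∑ ij ∈ antidiagonal (n + 1), rothe z ij.1 x * f ij.2 y)
      (IsPolynomialFun.sum _ fun ij => (isPolynomialFun_rothe z ij.1).mul (IsPolynomialFun.const _))
      ((hpoly (n + 1)).comp_add_const y) (fun m => ?_) x
    induction m with
    | zero => simp [Finset.Nat.sum_antidiagonal_succ, rothe_zero_right, rothe_zero]
    | succ m ihm =>
      rw [Finset.Nat.sum_antidiagonal_succ] at ihm ⊢
      have key : ∑ p ∈ antidiagonal n, rothe z (p.1 + 1) ((m + 1 : ℕ) : ℝ) * f p.2 y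
          = ∑ p ∈ antidiagonal n, rothe z (p.1 + 1) m * f p.2 y + f n (m + z + y) := by
        -- The hypothesis for `n` is needed at `m + z`, which need not be a natural number; this is
        -- why the extension to real `x` is made at each `n`.
        rw [← ih, ← Finset.sum_add_distrib]
        refine Finset.sum_congr rfl fun p _ => ?_
        push_cast
        rw [rothe_add_one]
        ring
      have h2 : f (n + 1) (((m + 1 : ℕ) : ℝ) + y) = f (n + 1) (m + y) + f n (m + z + y) := by
        push_cast
        rw [show (m : ℝ) + 1 + y = m + y + 1 by ring, hf]
        congr 2
        ring
      simp only [rothe_zero] at ihm ⊢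
      rw [key, h2, ← ihm]
      ring

theorem sum_rothe_mul_rothe (z : ℝ) (n : ℕ) (x y : ℝ) :
    ∑ ij ∈ antidiagonal n, rothe z ij.1 x * rothe z ij.2 y = rothe z n (x + y) :=
  sum_rothe_mul (fun _ _ => rfl) (rothe_add_one z) (isPolynomialFun_rothe z) n x y

theorem sum_rothe_mul_shiftedChoose (z : ℝ) (n : ℕ) (x y : ℝ) :
    ∑ ij ∈ antidiagonal n, rothe z ij.1 x * shiftedChoose z ij.2 y
      = shiftedChoose z n (x + y) :=
  sum_rothe_mul (fun _ _ => by simp [shiftedChoose]) (shiftedChoose_add_one z)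
    (isPolynomialFun_shiftedChoose z) n x y

/-- Links the polynomial form to the usual quotient `x / (x + zk) · C(x + zk, k)`, written without
division since `x + zk` may vanish. -/
theorem add_mul_rothe (z : ℝ) (k : ℕ) (x : ℝ) :
    (x + z * k) * rothe z k x = x * shiftedChoose z k x := by
  cases k with
  | zero => simp [rothe, shiftedChoose]
  | succ k =>
    have h := Ring.choose_smul_choose (x + z * ((k : ℝ) + 1)) (n := k + 1) (k := 1) (by omega)
    simp only [Nat.choose_one_right, Ring.choose_one_right, Nat.add_sub_cancel, nsmul_eq_mul] at h
    simp only [rothe, shiftedChoose]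
    push_cast at h ⊢
    rw [show x + (z - 1) + z * (k : ℝ) = x + z * ((k : ℝ) + 1) - 1 by ring]
    linear_combination z * h

theorem choose_eq_Gamma (k : ℕ) {y : ℝ} (hy : 0 < y + 1) :
    Ring.choose (y + k) k = Real.Gamma (y + k + 1) / (k.factorial * Real.Gamma (y + 1)) := by
  have hG := (Real.Gamma_pos_of_pos hy).ne'
  induction k with
  | zero => simp [hG]
  | succ k ih =>
    have h := Ring.choose_smul_choose (y + ((k : ℝ) + 1)) (n := k + 1) (k := 1) (by omega)
    simp only [Nat.choose_one_right, Ring.choose_one_right, Nat.add_sub_cancel, nsmul_eq_mul] at h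
    have hk : ((k : ℝ) + 1) ≠ 0 := by positivity
    have hf : (k.factorial : ℝ) ≠ 0 := by positivity
    push_cast at h ⊢
    rw [show y + ((k : ℝ) + 1) - 1 = y + k by ring, ih] at h
    refine mul_left_cancel₀ hk ?_
    have hyk : y + ((k : ℝ) + 1) ≠ 0 := by
      have : (0 : ℝ) ≤ k := k.cast_nonneg
      linarith
    rw [h, Real.Gamma_add_one hyk, ← add_assoc, Nat.factorial_succ]
    push_cast
    field_simp

/-! ### Normalized Bessel functions -/

/-- The order of the Bessel function attached to the parameter `p`: it is `(p - 1) / 2` for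
`h = 1` and `p` for `h = 2`. -/
def besselOrder (h : ℕ) (p : ℝ) : ℝ := (h * p + h - 2) / 2

/-- The coefficient of `x ^ (2 * k)` in the normalized Bessel function of order `ν`. -/
def besselCoeff (ν : ℝ) (k : ℕ) : ℝ :=
  (-1 / 4) ^ k * Real.Gamma (ν + 1) / (k.factorial * Real.Gamma (k + ν + 1))

/-- The normalized Bessel function `2 ^ ν Γ(ν + 1) J_ν(x) / x ^ ν`. -/
def normBessel (ν x : ℝ) : ℝ := ∑' k : ℕ, besselCoeff ν k * x ^ (2 * k)

theorem rothe_one_eq_Gamma {x : ℝ} (hx : 0 < x) (i : ℕ) :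
    rothe 1 i x = Real.Gamma (x + i) / (i.factorial * Real.Gamma x) := by
  have hxi : 0 < x + i := by positivity
  have h := add_mul_rothe 1 i x
  rw [shiftedChoose, one_mul, choose_eq_Gamma i (by linarith), Real.Gamma_add_one hxi.ne',
    Real.Gamma_add_one hx.ne'] at h
  refine mul_left_cancel₀ hxi.ne' (h.trans ?_)
  have := (Real.Gamma_pos_of_pos hx).ne'
  field_simp

theorem rothe_two_eq_Gamma {x : ℝ} (hx : 0 < x) (i : ℕ) :
    rothe 2 i x = x * Real.Gamma (2 * i + x) / (i.factorial * Real.Gamma (i + x + 1)) := by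
  have hxi : 0 < 2 * (i : ℝ) + x := by positivity
  have hG := (Real.Gamma_pos_of_pos (show 0 < (i : ℝ) + x + 1 by positivity)).ne'
  have h := add_mul_rothe 2 i x
  rw [shiftedChoose, show x + 2 * (i : ℝ) = (i + x) + i by ring,
    choose_eq_Gamma i (by positivity), show (i : ℝ) + x + i = 2 * i + x by ring,
    Real.Gamma_add_one hxi.ne'] at h
  refine mul_left_cancel₀ hxi.ne' (h.trans ?_)
  field_simp

/-- The bridge from Bessel series to combinatorics. For `h = 1` Legendre duplication at `p/2` and at
`p/2 + i` removes half of each `Γ(2i+p)`, `Γ(p)`; for `h = 2` the Gamma factors match directly. -/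
theorem besselCoeff_mul_Gamma {h : ℕ} (hh : h = 1 ∨ h = 2) {p : ℝ} (hp : 0 < p) (i : ℕ) :
    besselCoeff (besselOrder h p) i * Real.Gamma (2 * i + p) =
      Real.Gamma p * (-1 / (h : ℝ) ^ 2) ^ i * rothe h i (h * p / 2) := by
  rcases hh with rfl | rfl
  · have hp2 : 0 < p / 2 := by positivity
    have d0 := Real.Gamma_mul_Gamma_add_half (p / 2)
    have d1 := Real.Gamma_mul_Gamma_add_half (p / 2 + i)
    have e1 : (2 : ℝ) ^ (1 - 2 * (p / 2 + i)) = 2 ^ (1 - 2 * (p / 2)) * (4 ^ i)⁻¹ := by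
      rw [show 1 - 2 * (p / 2 + i) = 1 - 2 * (p / 2) - ((2 * i : ℕ) : ℝ) by push_cast; ring,
        Real.rpow_sub (by norm_num), Real.rpow_natCast, pow_mul]
      norm_num [div_eq_mul_inv]
    rw [e1, show 2 * (p / 2 + (i : ℝ)) = 2 * i + p by ring] at d1
    rw [show 2 * (p / 2) = p by ring] at d0 d1
    simp only [besselCoeff, besselOrder, Nat.cast_one, one_mul]
    rw [rothe_one_eq_Gamma hp2, show (p + 1 - 2) / 2 + 1 = p / 2 + 1 / 2 by ring,
      show (i : ℝ) + (p + 1 - 2) / 2 + 1 = p / 2 + i + 1 / 2 by ring]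
    have g0 := (Real.Gamma_pos_of_pos hp2).ne'
    have g1 := (Real.Gamma_pos_of_pos (show 0 < p / 2 + (i : ℝ) + 1 / 2 by positivity)).ne'
    have hc : (2 : ℝ) ^ (1 - p) * √Real.pi ≠ 0 := by positivity
    have h4 : (-1 / 4 : ℝ) ^ i = (-1) ^ i * (4 ^ i)⁻¹ := by
      rw [← inv_pow, ← mul_pow]; norm_num
    have key : Real.Gamma (p / 2 + 1 / 2) * (4 ^ i)⁻¹ * Real.Gamma (2 * i + p)
        * Real.Gamma (p / 2) = Real.Gamma p * Real.Gamma (p / 2 + i)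
          * Real.Gamma (p / 2 + i + 1 / 2) := by
      refine mul_left_cancel₀ hc ?_
      linear_combination ((4 : ℝ) ^ i)⁻¹ * Real.Gamma (2 * i + p) * (2 : ℝ) ^ (1 - p) * √Real.pi * d0
        - Real.Gamma p * (2 : ℝ) ^ (1 - p) * √Real.pi * d1
    rw [h4]
    field_simp
    field_simp at key
    linear_combination key
  · have hp1 : 0 < (i : ℝ) + p + 1 := by positivity
    have g1 := (Real.Gamma_pos_of_pos hp1).ne'
    simp only [besselCoeff, besselOrder, Nat.cast_ofNat]
    rw [show (2 * p + 2 - 2) / 2 = p by ring, show 2 * p / 2 = p by ring, rothe_two_eq_Gamma hp,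
      Real.Gamma_add_one hp.ne']
    norm_num
    field_simp

/-- The additional factor `2i + p` is `2/h` times `hp/2 + hi`, exactly the factor that turns a Rothe
coefficient into a shifted binomial. -/
theorem besselCoeff_mul_Gamma_add_one {h : ℕ} (hh : h = 1 ∨ h = 2) {p : ℝ} (hp : 0 < p) (i : ℕ) :
    besselCoeff (besselOrder h p) i * Real.Gamma (2 * i + p + 1) =
      Real.Gamma (p + 1) * (-1 / (h : ℝ) ^ 2) ^ i * shiftedChoose h i (h * p / 2) := by
  have h0 : (0 : ℝ) < h := by rcases hh with rfl | rfl <;> norm_num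
  have h1 := besselCoeff_mul_Gamma hh hp i
  have h2 := add_mul_rothe h i (h * p / 2)
  have hpi : 0 < 2 * (i : ℝ) + p := by positivity
  rw [Real.Gamma_add_one hp.ne', Real.Gamma_add_one hpi.ne']
  refine mul_left_cancel₀ h0.ne' ?_
  linear_combination (h : ℝ) * (2 * i + p) * h1 + 2 * Real.Gamma p * (-1 / (h : ℝ) ^ 2) ^ i * h2

theorem sum_besselCoeff_mul {h : ℕ} (hh : h = 1 ∨ h = 2) {p q : ℝ} (hp : 0 < p) (hq : 0 < q)
    {e : ℕ} (he : e ≤ 1) (n : ℕ) :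
    ∑ ij ∈ antidiagonal n, besselCoeff (besselOrder h p) ij.1 * Real.Gamma (2 * ij.1 + p) *
        (besselCoeff (besselOrder h q) ij.2 * Real.Gamma (2 * ij.2 + (q + e))) =
      Real.Gamma p * Real.Gamma (q + e) / Real.Gamma (p + (q + e)) *
        (besselCoeff (besselOrder h (p + q)) n * Real.Gamma (2 * n + (p + (q + e)))) := by
  have hpq : 0 < p + q := by positivity
  have hG : Real.Gamma (p + (q + e)) ≠ 0 := (Real.Gamma_pos_of_pos (by positivity)).ne'
  -- `F` is the Rothe coefficient for `e = 0` and the shifted binomial for `e = 1`; the left factor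
  -- is a Rothe coefficient in both cases.
  obtain ⟨F, hF, hconv⟩ : ∃ F : ℕ → ℝ → ℝ, (∀ r : ℝ, 0 < r → ∀ i : ℕ,
      besselCoeff (besselOrder h r) i * Real.Gamma (2 * i + (r + e)) =
        Real.Gamma (r + e) * (-1 / (h : ℝ) ^ 2) ^ i * F i (h * r / 2)) ∧
      ∀ x y, ∑ ij ∈ antidiagonal n, rothe h ij.1 x * F ij.2 y = F n (x + y) := by
    obtain rfl | rfl : e = 0 ∨ e = 1 := by omega
    · exact ⟨rothe h, fun r hr i => by simpa using besselCoeff_mul_Gamma hh hr i,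
        sum_rothe_mul_rothe h n⟩
    · exact ⟨shiftedChoose h, fun r hr i => by
        simpa [add_assoc] using besselCoeff_mul_Gamma_add_one hh hr i,
        sum_rothe_mul_shiftedChoose h n⟩
  have hx := hF (p + q) hpq n
  rw [add_assoc p q] at hx
  rw [hx, show (h : ℝ) * (p + q) / 2 = h * p / 2 + h * q / 2 by ring, ← hconv]
  simp only [Finset.mul_sum]
  refine Finset.sum_congr rfl fun ij hij => ?_
  rw [besselCoeff_mul_Gamma hh hp, hF q hq, ← Finset.HasAntidiagonal.mem_antidiagonal.mp hij, pow_add]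
  field_simp

theorem abs_besselCoeff_le {ν : ℝ} (hν : 0 ≤ ν) (k : ℕ) :
    |besselCoeff ν k| ≤ (1 / 4) ^ k / k.factorial := by
  have h0 : 0 < Real.Gamma (ν + 1) := Real.Gamma_pos_of_pos (by positivity)
  have hk : Real.Gamma (ν + 1) ≤ Real.Gamma (k + ν + 1) := by
    induction k with
    | zero => simp
    | succ k ih =>
      have hpos : 0 < (k : ℝ) + ν + 1 := by positivity
      push_cast
      rw [show (k : ℝ) + 1 + ν + 1 = k + ν + 1 + 1 by ring, Real.Gamma_add_one hpos.ne']
      refine ih.trans (le_mul_of_one_le_left (Real.Gamma_pos_of_pos hpos).le ?_)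
      have : (0 : ℝ) ≤ k := k.cast_nonneg
      linarith
  have hk0 := h0.trans_le hk
  rw [besselCoeff, abs_div, abs_mul, abs_pow, abs_of_pos h0, abs_of_pos (mul_pos (by positivity) hk0),
    show |(-1 / 4 : ℝ)| = 1 / 4 by rw [abs_of_neg] <;> norm_num]
  rw [div_le_div_iff₀ (by positivity) (by positivity)]
  have : (0 : ℝ) < (1 / 4) ^ k * k.factorial := by positivity
  nlinarith

theorem summable_abs_besselCoeff_mul {ν : ℝ} (hν : 0 ≤ ν) (x : ℝ) :
    Summable fun k : ℕ => |besselCoeff ν k| * x ^ (2 * k) := by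
  refine Summable.of_nonneg_of_le (fun k => by rw [pow_mul]; positivity) (fun k => ?_)
    (Real.summable_pow_div_factorial (x ^ 2 / 4))
  rw [pow_mul, div_eq_mul_one_div (x ^ 2), mul_pow, mul_div_assoc, mul_comm]
  exact mul_le_mul_of_nonneg_left (abs_besselCoeff_le hν k) (by positivity)

theorem summable_besselCoeff_mul {ν : ℝ} (hν : 0 ≤ ν) (x : ℝ) :
    Summable fun k : ℕ => besselCoeff ν k * x ^ (2 * k) := by
  refine Summable.of_norm ?_
  convert summable_abs_besselCoeff_mul hν x using 2 with k
  rw [norm_mul, Real.norm_eq_abs, norm_pow, pow_mul, pow_mul, Real.norm_eq_abs, sq_abs]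

theorem normBessel_zero {ν : ℝ} (hν : 0 ≤ ν) : normBessel ν 0 = 1 := by
  have hG : Real.Gamma (ν + 1) ≠ 0 := (Real.Gamma_pos_of_pos (by positivity)).ne'
  rw [normBessel, tsum_eq_single 0 (fun k hk => by simp [hk])]
  simp [besselCoeff, hG]

theorem normBessel_eq_besselJ (ν : ℝ) {x : ℝ} (hx : 0 < x) :
    2 ^ ν * Real.Gamma (ν + 1) / x ^ ν * besselJ ν x = normBessel ν x := by
  rw [besselJ, normBessel, ← tsum_mul_left]
  refine tsum_congr fun k => ?_
  have h1 : (x / 2) ^ (2 * (k : ℝ) + ν) = (x ^ 2 / 4) ^ k * (x ^ ν / 2 ^ ν) := by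
    rw [Real.rpow_add (by positivity), ← Real.div_rpow hx.le (by norm_num)]
    congr 1
    rw [show 2 * (k : ℝ) = ((2 * k : ℕ) : ℝ) by push_cast; ring, Real.rpow_natCast, pow_mul]
    congr 1
    ring
  have h2 : (0 : ℝ) < 2 ^ ν := by positivity
  have h3 : (0 : ℝ) < x ^ ν := by positivity
  have h4 : (-1 / 4 : ℝ) ^ k * x ^ (2 * k) = (-1) ^ k * (x ^ 2 / 4) ^ k := by
    rw [pow_mul, ← mul_pow, ← mul_pow]
    congr 1
    ring
  rw [h1, besselCoeff]
  calc _ = ((-1) ^ k * (x ^ 2 / 4) ^ k) * (Real.Gamma (ν + 1) / (k.factorial * Real.Gamma (k + ν + 1))) := by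
        field_simp
    _ = _ := by rw [← h4]; ring

/-! ### The Beta integral and the convolution formula -/

theorem integrableOn_rpow_mul_rpow {p q t : ℝ} (hp : 0 < p) (hq : 0 < q) (ht : 0 < t) :
    IntegrableOn (fun s : ℝ => s ^ (p - 1) * (t - s) ^ (q - 1)) (Set.Ioo 0 t) := by
  have h := Complex.betaIntegral_convergent (u := p) (v := q) (by simpa) (by simpa)
  have h' := h.comp_mul_left (c := t⁻¹)
  simp only [zero_div, one_div, inv_inv] at h'
  rw [intervalIntegrable_iff_integrableOn_Ioo_of_le ht.le] at h'
  refine ((h'.re.const_mul (t ^ (p - 1) * t ^ (q - 1)))).congr ?_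
  refine (ae_restrict_iff' measurableSet_Ioo).2 (Filter.Eventually.of_forall fun s hs => ?_)
  have h1 : 0 < t⁻¹ * s := mul_pos (inv_pos.2 ht) hs.1
  have h2 : 0 < 1 - t⁻¹ * s := by
    rw [sub_pos, inv_mul_lt_iff₀ ht]; linarith [hs.2]
  have hts : t - s = t * (1 - t⁻¹ * s) := by field_simp
  have hs' : s = t * (t⁻¹ * s) := by field_simp
  have e1 : ((t⁻¹ * s : ℝ) : ℂ) ^ ((p : ℂ) - 1) = ((t⁻¹ * s) ^ (p - 1) : ℝ) := by
    rw [Complex.ofReal_cpow h1.le]; push_cast; rfl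
  have e2 : (1 - ((t⁻¹ * s : ℝ) : ℂ)) ^ ((q : ℂ) - 1) = ((1 - t⁻¹ * s) ^ (q - 1) : ℝ) := by
    rw [Complex.ofReal_cpow h2.le]; push_cast; rfl
  simp only [e1, e2]
  rw [← Complex.ofReal_mul, RCLike.re_to_complex, Complex.ofReal_re, hts, Real.mul_rpow ht.le h2.le]
  conv_rhs => rw [hs', Real.mul_rpow ht.le h1.le]
  rw [← hs']
  ring

theorem integral_rpow_mul_rpow {p q t : ℝ} (hp : 0 < p) (hq : 0 < q) (ht : 0 < t) :
    ∫ s in Set.Ioo 0 t, s ^ (p - 1) * (t - s) ^ (q - 1) =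
      Real.Gamma p * Real.Gamma q / Real.Gamma (p + q) * t ^ (p + q - 1) := by
  have h := Complex.betaIntegral_scaled (p : ℂ) q ht
  rw [Complex.betaIntegral_eq_Gamma_mul_div _ _ (by simpa) (by simpa),
    intervalIntegral.integral_of_le ht.le, integral_Ioc_eq_integral_Ioo] at h
  have h1 : ∫ s in Set.Ioo 0 t, (s : ℂ) ^ ((p : ℂ) - 1) * ((t : ℂ) - s) ^ ((q : ℂ) - 1) =
      ((∫ s in Set.Ioo 0 t, s ^ (p - 1) * (t - s) ^ (q - 1) : ℝ) : ℂ) := by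
    rw [← integral_complex_ofReal]
    refine setIntegral_congr_fun measurableSet_Ioo fun s hs => ?_
    rw [Complex.ofReal_mul, Complex.ofReal_cpow hs.1.le, Complex.ofReal_cpow (sub_pos.2 hs.2).le]
    push_cast
    rfl
  rw [h1] at h
  apply Complex.ofReal_injective
  rw [h, mul_comm]
  push_cast [Complex.ofReal_cpow ht.le]
  rw [← Complex.Gamma_ofReal, ← Complex.Gamma_ofReal, ← Complex.Gamma_ofReal, Complex.ofReal_add]

/-- Both series are multiplied out and integrated termwise by the Beta integral. Its denominator and
its power of `t` depend only on `i + j`, so the terms group along antidiagonals, where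
`sum_besselCoeff_mul` applies. -/
theorem integral_normBessel_mul_normBessel {h : ℕ} (hh : h = 1 ∨ h = 2) {p q : ℝ}
    (hp : 0 < p) (hq : 0 < q) (hνp : 0 ≤ besselOrder h p) (hνq : 0 ≤ besselOrder h q)
    {e : ℕ} (he : e ≤ 1) (l : ℝ) {t : ℝ} (ht : 0 < t) :
    ∫ s in Set.Ioo 0 t, (s ^ (p - 1) * normBessel (besselOrder h p) (l * s)) *
        ((t - s) ^ (q + e - 1) * normBessel (besselOrder h q) (l * (t - s))) =
      Real.Gamma p * Real.Gamma (q + e) / Real.Gamma (p + (q + e)) * t ^ (p + (q + e) - 1) *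
        normBessel (besselOrder h (p + q)) (l * t) := by
  have hqe : 0 < q + e := by positivity
  set u := besselCoeff (besselOrder h p) with hu
  set v := besselCoeff (besselOrder h q) with hv
  let F : ℕ × ℕ → ℝ → ℝ := fun ij s => (u ij.1 * l ^ (2 * ij.1)) * (v ij.2 * l ^ (2 * ij.2)) *
    (s ^ (2 * ij.1 + p - 1) * (t - s) ^ (2 * ij.2 + (q + e) - 1))
  have hsplit : ∀ {x : ℝ}, 0 < x → ∀ (i : ℕ) (r : ℝ), x ^ (2 * i + r - 1) = x ^ (2 * i) * x ^ (r - 1) := by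
    intro x hx i r
    rw [show 2 * (i : ℝ) + r - 1 = ((2 * i : ℕ) : ℝ) + (r - 1) by push_cast; ring,
      Real.rpow_add hx, Real.rpow_natCast]
  have hFint : ∀ ij, Integrable (F ij) (volume.restrict (Set.Ioo 0 t)) := fun ij =>
    (integrableOn_rpow_mul_rpow (by positivity) (by positivity) ht).const_mul _
  have hFval : ∀ ij, ∫ s in Set.Ioo 0 t, F ij s = (u ij.1 * l ^ (2 * ij.1)) *
      (v ij.2 * l ^ (2 * ij.2)) * (Real.Gamma (2 * ij.1 + p) * Real.Gamma (2 * ij.2 + (q + e)) /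
        Real.Gamma (2 * ij.1 + p + (2 * ij.2 + (q + e))) *
        t ^ (2 * ij.1 + p + (2 * ij.2 + (q + e)) - 1)) := fun ij => by
    rw [integral_const_mul, integral_rpow_mul_rpow (by positivity) (by positivity) ht]
  have hbase := integrableOn_rpow_mul_rpow hp hqe ht
  -- Bounding `s` and `t - s` by `t` in the even powers leaves a single integrable Beta weight times
  -- the product of two absolutely convergent series at `l t`.
  have hFsum : Summable fun ij => ∫ s in Set.Ioo 0 t, ‖F ij s‖ := by
    have hs := ((summable_abs_besselCoeff_mul hνp (l * t)).mul_of_nonneg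
      (summable_abs_besselCoeff_mul hνq (l * t)) (fun k => by rw [pow_mul]; positivity)
      (fun k => by rw [pow_mul]; positivity)).mul_right
      (∫ s in Set.Ioo 0 t, s ^ (p - 1) * (t - s) ^ (q + e - 1))
    refine Summable.of_nonneg_of_le (fun ij => integral_nonneg fun s => norm_nonneg _)
      (fun ij => ?_) hs
    rw [← integral_const_mul]
    refine setIntegral_mono_on (hFint ij).norm (hbase.const_mul _) measurableSet_Ioo fun s hs => ?_
    have hts : 0 < t - s := sub_pos.2 hs.2
    have a1 : s ^ (2 * ij.1) ≤ t ^ (2 * ij.1) := pow_le_pow_left₀ hs.1.le hs.2.le _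
    have a2 : (t - s) ^ (2 * ij.2) ≤ t ^ (2 * ij.2) := pow_le_pow_left₀ hts.le (by linarith [hs.1]) _
    have hs0 := hs.1
    simp only [F]
    rw [hsplit hs.1, hsplit hts, norm_mul, norm_mul, norm_mul, norm_mul]
    rw [Real.norm_of_nonneg (r := l ^ (2 * ij.1)) (by rw [pow_mul]; positivity),
      Real.norm_of_nonneg (r := l ^ (2 * ij.2)) (by rw [pow_mul]; positivity),
      Real.norm_of_nonneg (r := _ * _) (by positivity), mul_pow, mul_pow, Real.norm_eq_abs, Real.norm_eq_abs]
    have l1 : 0 ≤ l ^ (2 * ij.1) := by rw [pow_mul]; positivity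
    have l2 : 0 ≤ l ^ (2 * ij.2) := by rw [pow_mul]; positivity
    calc _ = |u ij.1| * l ^ (2 * ij.1) * (|v ij.2| * l ^ (2 * ij.2)) *
          (s ^ (2 * ij.1) * (t - s) ^ (2 * ij.2)) * (s ^ (p - 1) * (t - s) ^ (q + e - 1)) := by ring
      _ ≤ |u ij.1| * l ^ (2 * ij.1) * (|v ij.2| * l ^ (2 * ij.2)) *
          (t ^ (2 * ij.1) * t ^ (2 * ij.2)) * (s ^ (p - 1) * (t - s) ^ (q + e - 1)) := by gcongr
      _ = _ := by ring
  have H := hasSum_integral_of_summable_integral_norm hFint hFsum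
  have hLHS : ∫ s in Set.Ioo 0 t, (s ^ (p - 1) * normBessel (besselOrder h p) (l * s)) *
        ((t - s) ^ (q + e - 1) * normBessel (besselOrder h q) (l * (t - s))) =
      ∫ s in Set.Ioo 0 t, ∑' ij, F ij s := by
    refine setIntegral_congr_fun measurableSet_Ioo fun s hs => ?_
    have hts : 0 < t - s := sub_pos.2 hs.2
    have s1 := summable_besselCoeff_mul hνp (l * s)
    have s2 := summable_besselCoeff_mul hνq (l * (t - s))
    have s3 := summable_mul_of_summable_norm s1.norm s2.norm
    simp only [normBessel]
    rw [mul_mul_mul_comm, s1.tsum_mul_tsum s2 s3, ← tsum_mul_left]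
    refine tsum_congr fun ij => ?_
    simp only [F]
    rw [hsplit hs.1, hsplit hts, mul_pow, mul_pow]
    ring
  have hsum : Summable fun c : Σ n : ℕ, antidiagonal n =>
      ∫ s in Set.Ioo 0 t, F (Finset.HasAntidiagonal.sigmaAntidiagonalEquivProd c) s :=
    Finset.HasAntidiagonal.sigmaAntidiagonalEquivProd.summable_iff.2 H.summable
  rw [hLHS, normBessel, ← tsum_mul_left, ← H.tsum_eq,
    ← Finset.HasAntidiagonal.sigmaAntidiagonalEquivProd.tsum_eq (fun ij => ∫ s in Set.Ioo 0 t, F ij s),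
    Summable.tsum_sigma' (fun n => (hasSum_fintype _).summable) hsum]
  refine tsum_congr fun n => ?_
  rw [tsum_fintype]
  simp only [Finset.HasAntidiagonal.sigmaAntidiagonalEquivProd_apply]
  rw [Finset.sum_coe_sort (antidiagonal n) fun ij => ∫ s in Set.Ioo 0 t, F ij s]
  have hG : Real.Gamma (2 * n + (p + (q + e))) ≠ 0 := (Real.Gamma_pos_of_pos (by positivity)).ne'
  have hcomb := sum_besselCoeff_mul hh hp hq he n
  have hterm : ∀ ij ∈ antidiagonal n, ∫ s in Set.Ioo 0 t, F ij s =
      u ij.1 * Real.Gamma (2 * ij.1 + p) * (v ij.2 * Real.Gamma (2 * ij.2 + (q + e))) *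
        (l ^ (2 * n) * t ^ (2 * n) * t ^ (p + (q + e) - 1) /
          Real.Gamma (2 * n + (p + (q + e)))) := fun ij hij => by
    have hn := Finset.HasAntidiagonal.mem_antidiagonal.mp hij
    rw [hFval, show 2 * (ij.1 : ℝ) + p + (2 * ij.2 + (q + e)) = 2 * n + (p + (q + e)) by
      rw [← hn]; push_cast; ring, hsplit ht, ← hn, mul_add, pow_add l]
    ring
  rw [Finset.sum_congr rfl hterm, ← Finset.sum_mul, hcomb, mul_pow]
  field_simp

/-! ### The characteristic function of the uniform distribution on the sphere -/

/-- Polar coordinates on the complement of the null set `{0}`: homogeneity of `⟪x, α⟫ ^ m` separates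
direction from radius. Comparison with the Cartesian value of the same Gaussian integral gives the
sphere moments. -/
theorem integral_pow_inner_mul_exp_neg_sq_polar {E : Type*} [NormedAddCommGroup E]
    [InnerProductSpace ℝ E] [Nontrivial E] [FiniteDimensional ℝ E] [MeasurableSpace E] [BorelSpace E]
    (α : E) (m : ℕ) :
    ∫ x : E, (inner ℝ x α) ^ m * Real.exp (-‖x‖ ^ 2) =
      (∫ v : Metric.sphere (0 : E) 1, (inner ℝ (v : E) α) ^ m ∂(volume : Measure E).toSphere) *
        ∫ r : Set.Ioi (0 : ℝ), r.1 ^ m * Real.exp (-r.1 ^ 2)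
          ∂(Measure.volumeIoiPow (Module.finrank ℝ E - 1)) := by
  calc
    _ = ∫ x : ({(0 : E)}ᶜ : Set E), (inner ℝ (x : E) α) ^ m * Real.exp (-‖(x : E)‖ ^ 2)
          ∂((volume : Measure E).comap (↑)) := by
      rw [integral_subtype_comap (measurableSet_singleton (0 : E)).compl
        fun x : E => (inner ℝ x α) ^ m * Real.exp (-‖x‖ ^ 2), restrict_compl_singleton]
    _ = ∫ x : Metric.sphere (0 : E) 1 × Set.Ioi (0 : ℝ),
          (inner ℝ (x.1 : E) α) ^ m * (x.2.1 ^ m * Real.exp (-x.2.1 ^ 2))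
          ∂((volume : Measure E).toSphere.prod
            (Measure.volumeIoiPow (Module.finrank ℝ E - 1))) := by
      rw [← (volume : Measure E).measurePreserving_homeomorphUnitSphereProd.integral_comp
        (homeomorphUnitSphereProd E).measurableEmbedding]
      refine integral_congr_ae (Filter.Eventually.of_forall fun x => ?_)
      have hx : ‖(x : E)‖ ≠ 0 := norm_ne_zero_iff.2 x.2
      simp only [homeomorphUnitSphereProd_apply_snd_coe, homeomorphUnitSphereProd_apply_fst_coe,
        inner_smul_left, mul_pow, RCLike.conj_to_real, inv_pow]
      field_simp
    _ = _ := integral_prod_mul (fun v : Metric.sphere (0 : E) 1 => (inner ℝ (v : E) α) ^ m)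
      (fun r : Set.Ioi (0 : ℝ) => r.1 ^ m * Real.exp (-r.1 ^ 2))

theorem integral_pow_volumeIoiPow (m n : ℕ) :
    ∫ r : Set.Ioi (0 : ℝ), r.1 ^ m * Real.exp (-r.1 ^ 2) ∂(Measure.volumeIoiPow n) =
      Real.Gamma ((n + m + 1) / 2) / 2 := by
  simp only [Measure.volumeIoiPow, ENNReal.ofReal]
  rw [integral_withDensity_eq_integral_smul ((measurable_subtype_coe.pow_const _).real_toNNReal),
    integral_subtype_comap measurableSet_Ioi
      fun a : ℝ => Real.toNNReal (a ^ n) • (a ^ m * Real.exp (-a ^ 2))]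
  have h := integral_rpow_mul_exp_neg_rpow (p := 2) (q := n + m) (by norm_num)
    (by have : (0 : ℝ) ≤ n + m := by positivity
        linarith)
  rw [one_div_mul_eq_div] at h
  rw [← h]
  refine setIntegral_congr_fun measurableSet_Ioi fun x hx => ?_
  have hx0 : (0 : ℝ) < x := hx
  rw [NNReal.smul_def, Real.coe_toNNReal _ (by positivity), smul_eq_mul, Real.rpow_add hx0,
    Real.rpow_natCast, Real.rpow_natCast, Real.rpow_two]
  ring

theorem integral_even_pow_mul_exp_neg_sq (k : ℕ) :
    ∫ x : ℝ, x ^ (2 * k) * Real.exp (-x ^ 2) = Real.Gamma (k + 1 / 2) := by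
  have h := integral_comp_abs (f := fun x : ℝ => x ^ (2 * k) * Real.exp (-x ^ 2))
  have h2 := integral_rpow_mul_exp_neg_rpow (p := 2) (q := (2 * k : ℕ)) (by norm_num)
    (by have : (0 : ℝ) ≤ (2 * k : ℕ) := by positivity
        linarith)
  simp only [pow_mul, sq_abs] at h
  simp only [pow_mul]
  simp only [Real.rpow_natCast, Real.rpow_two, pow_mul] at h2
  rw [h, h2]
  rw [show ((2 * k : ℕ) + 1 : ℝ) / 2 = k + 1 / 2 by push_cast; ring]
  ring

theorem integral_odd_pow_mul_exp_neg_sq (k : ℕ) :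
    ∫ x : ℝ, x ^ (2 * k + 1) * Real.exp (-x ^ 2) = 0 := by
  have h := integral_neg_eq_self (fun x : ℝ => x ^ (2 * k + 1) * Real.exp (-x ^ 2)) volume
  simp only [(odd_two_mul_add_one k).neg_pow, neg_mul, integral_neg, neg_sq] at h
  linarith

theorem exists_linearIsometryEquiv_apply_eq {E : Type*} [NormedAddCommGroup E]
    [InnerProductSpace ℝ E] {x y : E} (h : ‖x‖ = ‖y‖) : ∃ R : E ≃ₗᵢ[ℝ] E, R x = y :=
  ⟨_, Submodule.reflection_sub h⟩

theorem integral_pow_inner_mul_exp_neg_sq {d : ℕ} (hd : 1 ≤ d) (α : EuclideanSpace ℝ (Fin d))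
    (m : ℕ) :
    ∫ x : EuclideanSpace ℝ (Fin d), (inner ℝ x α) ^ m * Real.exp (-‖x‖ ^ 2) =
      ‖α‖ ^ m * √Real.pi ^ (d - 1) * ∫ x : ℝ, x ^ m * Real.exp (-x ^ 2) := by
  obtain ⟨d, rfl⟩ : ∃ k, d = k + 1 := ⟨d - 1, by omega⟩
  -- Rotating `α` onto the first axis makes the integrand a product over coordinates.
  obtain ⟨R, hR⟩ := exists_linearIsometryEquiv_apply_eq (x := α)
    (y := EuclideanSpace.single (0 : Fin (d + 1)) ‖α‖) (by simp)
  have h1 := R.measurePreserving.integral_comp R.toHomeomorph.measurableEmbedding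
    (fun x => (inner ℝ x (EuclideanSpace.single (0 : Fin (d + 1)) ‖α‖)) ^ m * Real.exp (-‖x‖ ^ 2))
  simp only [← hR, LinearIsometryEquiv.inner_map_map, LinearIsometryEquiv.norm_map] at h1
  rw [h1, hR, ← (PiLp.volume_preserving_toLp (Fin (d + 1))).integral_comp
    (MeasurableEquiv.toLp 2 _).measurableEmbedding]
  have h2 : ∀ x : Fin (d + 1) → ℝ,
      (inner ℝ (WithLp.toLp 2 x) (EuclideanSpace.single (0 : Fin (d + 1)) ‖α‖)) ^ m *
        Real.exp (-‖WithLp.toLp 2 x‖ ^ 2) =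
      ∏ i, (Fin.cons (fun y : ℝ => (‖α‖ * y) ^ m * Real.exp (-y ^ 2))
        (fun _ y => Real.exp (-y ^ 2)) : Fin (d + 1) → ℝ → ℝ) i (x i) := fun x => by
    rw [Fin.prod_univ_succ, EuclideanSpace.real_norm_sq_eq, ← Finset.sum_neg_distrib, Real.exp_sum,
      Fin.prod_univ_succ]
    simp [EuclideanSpace.inner_single_right, mul_assoc]
  simp only [h2]
  rw [integral_fintype_prod_volume_eq_prod, Fin.prod_univ_succ]
  simp only [Fin.cons_zero, Fin.cons_succ, Finset.prod_const, Finset.card_univ, Fintype.card_fin,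
    mul_pow, mul_assoc, integral_const_mul, Nat.add_sub_cancel]
  have h3 := integral_gaussian 1
  simp only [neg_mul, one_mul, div_one] at h3
  rw [h3]
  ring

theorem Gamma_nat_add_half_eq (k : ℕ) :
    Real.Gamma (k + 1 / 2) * (4 ^ k * k.factorial) = (2 * k).factorial * √Real.pi := by
  have h := Real.Gamma_mul_Gamma_add_half (k + 1 / 2)
  rw [show (k : ℝ) + 1 / 2 + 1 / 2 = k + 1 by ring, Real.Gamma_nat_eq_factorial,
    show 2 * ((k : ℝ) + 1 / 2) = (2 * k : ℕ) + 1 by push_cast; ring, Real.Gamma_nat_eq_factorial,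
    show 1 - (((2 * k : ℕ) : ℝ) + 1) = -((2 * k : ℕ) : ℝ) by ring, Real.rpow_neg (by norm_num),
    Real.rpow_natCast, pow_mul] at h
  norm_num at h
  field_simp at h
  rw [← h]
  ring_nf

section Sphere

variable {d : ℕ}

theorem sphere_moment_mul (hd : 1 ≤ d) (α : EuclideanSpace ℝ (Fin d)) (m : ℕ) :
    (∫ v : Metric.sphere (0 : EuclideanSpace ℝ (Fin d)) 1,
      (inner ℝ (v : EuclideanSpace ℝ (Fin d)) α) ^ m
        ∂(volume : Measure (EuclideanSpace ℝ (Fin d))).toSphere) * (Real.Gamma ((d + m) / 2) / 2) =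
      ‖α‖ ^ m * √Real.pi ^ (d - 1) * ∫ x : ℝ, x ^ m * Real.exp (-x ^ 2) := by
  have : Nonempty (Fin d) := ⟨⟨0, hd⟩⟩
  rw [← integral_pow_inner_mul_exp_neg_sq hd, integral_pow_inner_mul_exp_neg_sq_polar,
    integral_pow_volumeIoiPow, finrank_euclideanSpace_fin, Nat.cast_sub hd]
  congr 4
  push_cast
  ring

theorem isProbabilityMeasure_uniformSphere (hd : 1 ≤ d) :
    IsProbabilityMeasure (uniformSphere d) := by
  have : Nonempty (Fin d) := ⟨⟨0, hd⟩⟩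
  have h0 : (volume : Measure (EuclideanSpace ℝ (Fin d))).toSphere Set.univ ≠ 0 := by
    rw [Ne, Measure.measure_univ_eq_zero]
    exact Measure.toSphere_ne_zero _
  exact ⟨by rw [uniformSphere, Measure.smul_apply, smul_eq_mul,
    ENNReal.inv_mul_cancel h0 (measure_ne_top _ _)]⟩

/-- Quotient of `sphere_moment_mul` at `m` by its instance at 0, which evaluates the total surface
mass. -/
theorem integral_inner_pow_uniformSphere (hd : 1 ≤ d) (α : EuclideanSpace ℝ (Fin d)) (m : ℕ) :
    (∫ v, (inner ℝ (v : EuclideanSpace ℝ (Fin d)) α) ^ m ∂uniformSphere d) *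
      (√Real.pi * Real.Gamma ((d + m) / 2)) =
      ‖α‖ ^ m * Real.Gamma (d / 2) * ∫ x : ℝ, x ^ m * Real.exp (-x ^ 2) := by
  have hd0 : (0 : ℝ) < d := by exact_mod_cast hd
  have h0 := sphere_moment_mul hd α 0
  have hm := sphere_moment_mul hd α m
  have g := integral_even_pow_mul_exp_neg_sq 0
  simp only [mul_zero, pow_zero, one_mul, Nat.cast_zero, zero_add, add_zero,
    Real.Gamma_one_half_eq, integral_const, smul_eq_mul, mul_one, Measure.real] at h0 g
  rw [g] at h0
  set S := (volume : Measure (EuclideanSpace ℝ (Fin d))).toSphere with hS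
  have hG := Real.Gamma_pos_of_pos (show 0 < (d : ℝ) / 2 by positivity)
  have hpi : 0 < √Real.pi := by positivity
  have hS0 : (S Set.univ).toReal ≠ 0 := by
    intro h
    rw [h] at h0
    have : 0 < √Real.pi ^ (d - 1) * √Real.pi := by positivity
    linarith
  rw [uniformSphere, integral_smul_measure, ENNReal.toReal_inv, smul_eq_mul, ← hS]
  have hc : √Real.pi ^ (d - 1) ≠ 0 := by positivity
  refine mul_left_cancel₀ (mul_ne_zero hS0 hc) ?_
  field_simp
  linear_combination 2 * √Real.pi * hm - 2 * ‖α‖ ^ m * (∫ x : ℝ, x ^ m * Real.exp (-x ^ 2)) * h0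

/-- The exponential series is integrated term by term; odd moments vanish, and the even ones become
the Bessel coefficients through `Γ(k + 1/2) 4^k k! = (2k)! √π`. -/
theorem integral_cexp_inner_uniformSphere (hd : 1 ≤ d) (α : EuclideanSpace ℝ (Fin d)) :
    ∫ v, Complex.exp ((inner ℝ (v : EuclideanSpace ℝ (Fin d)) α : ℝ) * Complex.I)
      ∂uniformSphere d = normBessel ((d : ℝ) / 2 - 1) ‖α‖ := by
  have := isProbabilityMeasure_uniformSphere hd
  have hd0 : (0 : ℝ) < d := by exact_mod_cast hd
  let F : ℕ → Metric.sphere (0 : EuclideanSpace ℝ (Fin d)) 1 → ℂ := fun m v =>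
    ((inner ℝ (v : EuclideanSpace ℝ (Fin d)) α : ℝ) * Complex.I) ^ m / m.factorial
  have hFcont : ∀ m, Continuous (F m) := fun m => by fun_prop
  have hFbound : ∀ m v, ‖F m v‖ ≤ ‖α‖ ^ m / m.factorial := fun m v => by
    have hv : |inner ℝ (v : EuclideanSpace ℝ (Fin d)) α| ≤ ‖α‖ := by
      simpa using abs_real_inner_le_norm (v : EuclideanSpace ℝ (Fin d)) α
    simp only [F, norm_div, norm_pow, norm_mul, Complex.norm_I, mul_one, Complex.norm_real,
      Real.norm_eq_abs, Complex.norm_natCast]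
    gcongr
  have hFint : ∀ m, Integrable (F m) (uniformSphere d) := fun m =>
    Integrable.of_bound (hFcont m).aestronglyMeasurable _
      (Filter.Eventually.of_forall (hFbound m))
  have hsum : Summable fun m => ∫ v, ‖F m v‖ ∂uniformSphere d := by
    refine Summable.of_nonneg_of_le (fun m => integral_nonneg fun _ => norm_nonneg _) (fun m => ?_)
      (Real.summable_pow_div_factorial ‖α‖)
    calc _ ≤ ∫ _, ‖α‖ ^ m / m.factorial ∂uniformSphere d :=
          integral_mono (hFint m).norm (integrable_const _) (hFbound m)
      _ = _ := by simp
  have H := hasSum_integral_of_summable_integral_norm hFint hsum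
  have hexp : ∀ v, ∑' m, F m v =
      Complex.exp ((inner ℝ (v : EuclideanSpace ℝ (Fin d)) α : ℝ) * Complex.I) := fun v => by
    rw [Complex.exp_eq_exp_ℂ, NormedSpace.exp_eq_tsum_div]
  simp only [hexp] at H
  have hval : ∀ m, ∫ v, F m v ∂uniformSphere d =
      ((∫ v, (inner ℝ (v : EuclideanSpace ℝ (Fin d)) α) ^ m ∂uniformSphere d : ℝ) : ℂ) *
        Complex.I ^ m / m.factorial := fun m => by
    simp only [F, mul_pow]
    rw [integral_div, integral_mul_const, ← integral_complex_ofReal]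
    push_cast
    rfl
  have hpi : √Real.pi ≠ 0 := by positivity
  have hodd : ∀ m, m ∉ Set.range (fun k : ℕ => 2 * k) → ∫ v, F m v ∂uniformSphere d = 0 := by
    intro m hm
    obtain ⟨k, rfl⟩ | ⟨k, rfl⟩ := m.even_or_odd
    · exact absurd ⟨k, two_mul k⟩ hm
    · have h := integral_inner_pow_uniformSphere hd α (2 * k + 1)
      have hG := (Real.Gamma_pos_of_pos
        (show 0 < ((d : ℝ) + (2 * k + 1 : ℕ)) / 2 by positivity)).ne'
      rw [integral_odd_pow_mul_exp_neg_sq, mul_zero] at h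
      have h' := (mul_eq_zero.1 h).resolve_right (mul_ne_zero hpi hG)
      rw [hval, h']
      simp
  rw [← (mul_right_injective₀ (two_ne_zero (α := ℕ))).hasSum_iff hodd] at H
  rw [← H.tsum_eq, normBessel, Complex.ofReal_tsum]
  refine tsum_congr fun k => ?_
  have h := integral_inner_pow_uniformSphere hd α (2 * k)
  have hG := (Real.Gamma_pos_of_pos (show 0 < (k : ℝ) + d / 2 by positivity)).ne'
  have hk := Gamma_nat_add_half_eq k
  rw [integral_even_pow_mul_exp_neg_sq,
    show ((d : ℝ) + (2 * k : ℕ)) / 2 = k + d / 2 by push_cast; ring] at h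
  rw [Function.comp_apply, hval, pow_mul Complex.I, Complex.I_sq]
  norm_cast
  rw [besselCoeff, show (d : ℝ) / 2 - 1 + 1 = d / 2 by ring,
    show (k : ℝ) + (d / 2 - 1) + 1 = k + d / 2 by ring]
  have h4 : (-1 / 4 : ℝ) ^ k * 4 ^ k = (-1) ^ k := by
    rw [← mul_pow]; norm_num
  have hf : ((2 * k).factorial : ℝ) ≠ 0 := by positivity
  have hf' : (k.factorial : ℝ) ≠ 0 := by positivity
  push_cast
  rw [← h4]
  have hmom : (∫ v, (inner ℝ (v : EuclideanSpace ℝ (Fin d)) α) ^ (2 * k) ∂uniformSphere d) *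
      (4 ^ k * k.factorial * Real.Gamma (k + d / 2)) =
      ‖α‖ ^ (2 * k) * Real.Gamma (d / 2) * (2 * k).factorial := by
    refine mul_left_cancel₀ hpi ?_
    linear_combination (4 ^ k * k.factorial : ℝ) * h + ‖α‖ ^ (2 * k) * Real.Gamma (d / 2) * hk
  rw [div_mul_eq_mul_div, div_eq_div_iff hf (mul_ne_zero hf' hG)]
  linear_combination (-1 / 4 : ℝ) ^ k * hmom

end Sphere

/-! ### Integration over the simplex -/

theorem Fin.sum_Iio_succ {n : ℕ} (f : Fin (n + 1) → ℝ) (k : Fin n) :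
    ∑ j ∈ Finset.Iio k.succ, f j = f 0 + ∑ j ∈ Finset.Iio k, f j.succ := by
  have h : Finset.Iio k.succ = insert 0 ((Finset.Iio k).map (Fin.succEmb n)) := by
    ext i
    cases i using Fin.cases <;> simp
  rw [h, Finset.sum_insert (by simp), Finset.sum_map]
  rfl

theorem Fin.sum_Iic_succ {n : ℕ} (f : Fin (n + 1) → ℝ) (k : Fin n) :
    ∑ j ∈ Finset.Iic k.succ, f j = f 0 + ∑ j ∈ Finset.Iic k, f j.succ := by
  have h : Finset.Iic k.succ = insert 0 ((Finset.Iic k).map (Fin.succEmb n)) := by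
    ext i
    cases i using Fin.cases <;> simp
  rw [h, Finset.sum_insert (by simp), Finset.sum_map]
  rfl

theorem Fin.sum_Iic_eq_sum_Iio_add {n : ℕ} (f : Fin n → ℝ) (k : Fin n) :
    ∑ j ∈ Finset.Iic k, f j = ∑ j ∈ Finset.Iio k, f j + f k := by
  rw [← Finset.Iio_insert, Finset.sum_insert (by simp), add_comm]

theorem measurableSet_timeSimplex (n : ℕ) (t : ℝ) : MeasurableSet (timeSimplex n t) := by
  have : timeSimplex n t =
      ⋂ k, ({τ | 0 < τ k} ∩ {τ | τ k < t - ∑ j ∈ Finset.Iio k, τ j}) := by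
    ext; simp [timeSimplex]
  rw [this]
  exact MeasurableSet.iInter fun k => (measurableSet_lt (by fun_prop) (by fun_prop)).inter
    (measurableSet_lt (by fun_prop) (by fun_prop))

theorem timeSimplex_zero (t : ℝ) : timeSimplex 0 t = Set.univ := by
  ext; simp [timeSimplex]

theorem cons_mem_timeSimplex {n : ℕ} {t s : ℝ} {τ : Fin n → ℝ} :
    (Fin.cons s τ : Fin (n + 1) → ℝ) ∈ timeSimplex (n + 1) t ↔
      s ∈ Set.Ioo 0 t ∧ τ ∈ timeSimplex n (t - s) := by
  have h0 : Finset.Iio (0 : Fin (n + 1)) = ∅ := by ext; simp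
  simp only [timeSimplex, Set.mem_ofPred_eq, Fin.forall_fin_succ, Fin.sum_Iio_succ, Fin.cons_zero,
    Fin.cons_succ, h0, Finset.sum_empty, sub_zero, Set.mem_Ioo, sub_sub]

theorem sub_sum_Iic_pos {n : ℕ} {t : ℝ} {τ : Fin n → ℝ} (hτ : τ ∈ timeSimplex n t) (k : Fin n) :
    0 < t - ∑ j ∈ Finset.Iic k, τ j := by
  rw [Fin.sum_Iic_eq_sum_Iio_add]
  linarith [(hτ k).2]

theorem measurePreserving_finCons (n : ℕ) :
    MeasurePreserving (fun x : ℝ × (Fin n → ℝ) => (Fin.cons x.1 x.2 : Fin (n + 1) → ℝ)) := by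
  have h := (volume_preserving_piFinSuccAbove (fun _ : Fin (n + 1) => ℝ) 0).symm
  simp only [MeasurableEquiv.piFinSuccAbove, Fin.insertNthEquiv_zero] at h
  exact h

theorem measurableEmbedding_finCons (n : ℕ) :
    MeasurableEmbedding
      (fun x : ℝ × (Fin n → ℝ) => (Fin.cons x.1 x.2 : Fin (n + 1) → ℝ)) := by
  have h := (MeasurableEquiv.piFinSuccAbove (fun _ : Fin (n + 1) => ℝ) 0).symm.measurableEmbedding
  simp only [MeasurableEquiv.piFinSuccAbove, Fin.insertNthEquiv_zero] at h
  exact h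

theorem indicator_timeSimplex_cons {n : ℕ} {M : Type*} [Zero M] (f : (Fin (n + 1) → ℝ) → M)
    (t s : ℝ) (τ : Fin n → ℝ) :
    (timeSimplex (n + 1) t).indicator f (Fin.cons s τ) =
      (Set.Ioo 0 t).indicator (fun s => (timeSimplex n (t - s)).indicator
        (fun τ => f (Fin.cons s τ)) τ) s := by
  by_cases h1 : s ∈ Set.Ioo 0 t
  · by_cases h2 : τ ∈ timeSimplex n (t - s)
    · rw [Set.indicator_of_mem (cons_mem_timeSimplex.2 ⟨h1, h2⟩), Set.indicator_of_mem h1,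
        Set.indicator_of_mem h2]
    · rw [Set.indicator_of_notMem fun h => h2 (cons_mem_timeSimplex.1 h).2,
        Set.indicator_of_mem h1, Set.indicator_of_notMem h2]
  · rw [Set.indicator_of_notMem fun h => h1 (cons_mem_timeSimplex.1 h).1,
      Set.indicator_of_notMem h1]

theorem setLIntegral_timeSimplex_succ {n : ℕ} (t : ℝ) {f : (Fin (n + 1) → ℝ) → ENNReal}
    (hf : Measurable f) :
    ∫⁻ τ in timeSimplex (n + 1) t, f τ =
      ∫⁻ s in Set.Ioo 0 t, ∫⁻ τ in timeSimplex n (t - s), f (Fin.cons s τ) := by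
  have hm := hf.indicator (measurableSet_timeSimplex (n + 1) t)
  rw [← lintegral_indicator (measurableSet_timeSimplex _ _),
    ← (measurePreserving_finCons n).lintegral_comp hm, Measure.volume_eq_prod,
    lintegral_prod (fun x : ℝ × (Fin n → ℝ) => (timeSimplex (n + 1) t).indicator f (Fin.cons x.1 x.2))
      (hm.comp (measurePreserving_finCons n).measurable).aemeasurable,
    ← lintegral_indicator measurableSet_Ioo]
  refine lintegral_congr fun s => ?_
  simp only [indicator_timeSimplex_cons]
  by_cases hs : s ∈ Set.Ioo 0 t
  · simp [hs, lintegral_indicator (measurableSet_timeSimplex _ _)]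
  · simp [hs]

theorem setIntegral_timeSimplex_succ {n : ℕ} {t : ℝ} {f : (Fin (n + 1) → ℝ) → ℝ}
    (hf : IntegrableOn f (timeSimplex (n + 1) t)) :
    ∫ τ in timeSimplex (n + 1) t, f τ =
      ∫ s in Set.Ioo 0 t, ∫ τ in timeSimplex n (t - s), f (Fin.cons s τ) := by
  have hemb := measurableEmbedding_finCons n
  have hm := (integrable_indicator_iff (measurableSet_timeSimplex _ _)).2 hf
  rw [← integral_indicator (measurableSet_timeSimplex _ _),
    ← (measurePreserving_finCons n).integral_comp hemb, Measure.volume_eq_prod,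
    integral_prod (fun x : ℝ × (Fin n → ℝ) =>
      (timeSimplex (n + 1) t).indicator f (Fin.cons x.1 x.2))
      (((measurePreserving_finCons n).integrable_comp_emb hemb).2 hm),
    ← integral_indicator measurableSet_Ioo]
  refine integral_congr_ae (Filter.Eventually.of_forall fun s => ?_)
  simp only [indicator_timeSimplex_cons]
  by_cases hs : s ∈ Set.Ioo 0 t
  · simp [hs, integral_indicator (measurableSet_timeSimplex _ _)]
  · simp [hs]

/-! ### Normalization of the generalized Dirichlet distribution -/

/-- The generalized Dirichlet density without its normalizing constant. -/
def gdWeight {n : ℕ} (a b : Fin n → ℝ) (t : ℝ) (τ : Fin n → ℝ) : ℝ :=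
  ∏ k, (τ k ^ (a k - 1) * (t - ∑ j ∈ Finset.Iic k, τ j) ^ (b k - 1))

theorem gdWeight_cons {n : ℕ} (a b : Fin (n + 1) → ℝ) (t s : ℝ) (τ : Fin n → ℝ) :
    gdWeight a b t (Fin.cons s τ) = s ^ (a 0 - 1) * (t - s) ^ (b 0 - 1) *
      gdWeight (Fin.tail a) (Fin.tail b) (t - s) τ := by
  have h0 : Finset.Iic (0 : Fin (n + 1)) = {0} := by ext; simp
  simp only [gdWeight, Fin.prod_univ_succ, Fin.sum_Iic_succ, Fin.cons_zero, Fin.cons_succ, h0,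
    Finset.sum_singleton, sub_sub, Fin.tail]

theorem measurable_gdWeight {n : ℕ} (a b : Fin n → ℝ) (t : ℝ) : Measurable (gdWeight a b t) := by
  unfold gdWeight
  fun_prop

theorem gdWeight_nonneg {n : ℕ} (a b : Fin n → ℝ) {t : ℝ} {τ : Fin n → ℝ}
    (hτ : τ ∈ timeSimplex n t) : 0 ≤ gdWeight a b t τ :=
  Finset.prod_nonneg fun k _ => mul_nonneg (Real.rpow_nonneg (hτ k).1.le _)
    (Real.rpow_nonneg (sub_sum_Iic_pos hτ k).le _)

/-- The positivity conditions under which the generalized Dirichlet density is integrable. -/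
structure GDAdmissible {n : ℕ} (a b : Fin n → ℝ) : Prop where
  left_pos : ∀ k, 0 < a k
  right_pos : ∀ k, 0 < b k + ∑ j ∈ Finset.Ioi k, (a j + b j - 1)

theorem GDAdmissible.tail {n : ℕ} {a b : Fin (n + 1) → ℝ} (h : GDAdmissible a b) :
    GDAdmissible (Fin.tail a) (Fin.tail b) where
  left_pos k := h.left_pos k.succ
  right_pos k := by
    have := h.right_pos k.succ
    rwa [← Fin.map_succEmb_Ioi, Finset.sum_map] at this

/-- The last factor does not depend on `r`, by scaling, so `r` is left free: positivity uses `r =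
t`, the normalization uses `r = 1`. -/
theorem gdConst_succ {n : ℕ} (a b : Fin (n + 1) → ℝ) (t : ℝ) {r : ℝ} (hr : 0 < r) :
    gdConst a b t = 1 / t ^ (a 0 + b 0 - 1 + ∑ k, (Fin.tail a k + Fin.tail b k - 1)) *
      (Real.Gamma (a 0 + (b 0 + ∑ k, (Fin.tail a k + Fin.tail b k - 1))) /
        (Real.Gamma (a 0) * Real.Gamma (b 0 + ∑ k, (Fin.tail a k + Fin.tail b k - 1)))) *
      (r ^ (∑ k, (Fin.tail a k + Fin.tail b k - 1)) * gdConst (Fin.tail a) (Fin.tail b) r) := by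
  have h0 : Finset.Ici (0 : Fin (n + 1)) = Finset.univ := by ext; simp
  have h1 : Finset.Ioi (0 : Fin (n + 1)) = Finset.univ.map (Fin.succEmb n) := by
    ext i; cases i using Fin.cases <;> simp
  simp only [gdConst, Fin.prod_univ_succ, h0, h1, Fin.sum_univ_succ, Finset.sum_map,
    ← Fin.map_succEmb_Ici, ← Fin.map_succEmb_Ioi, Fin.coe_succEmb, Fin.tail]
  have hr' := (Real.rpow_pos_of_pos hr (∑ k, (a (Fin.succ k) + b (Fin.succ k) - 1))).ne'
  rw [show ∀ N : ℝ, 1 + (a 0 + b 0 - 1 + N) = a 0 + (b 0 + N) from fun N => by ring]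
  field_simp

theorem GDAdmissible.zero_right_pos {n : ℕ} {a b : Fin (n + 1) → ℝ} (h : GDAdmissible a b) :
    0 < b 0 + ∑ k, (Fin.tail a k + Fin.tail b k - 1) := by
  have h1 : Finset.Ioi (0 : Fin (n + 1)) = Finset.univ.map (Fin.succEmb n) := by
    ext i; cases i using Fin.cases <;> simp
  have := h.right_pos 0
  rwa [h1, Finset.sum_map] at this

theorem GDAdmissible.gdConst_pos {n : ℕ} {a b : Fin n → ℝ} (h : GDAdmissible a b) {t : ℝ}
    (ht : 0 < t) : 0 < gdConst a b t := by
  induction n generalizing t with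
  | zero => simp [gdConst]
  | succ n ih =>
    rw [gdConst_succ a b t ht]
    have h1 := h.left_pos 0
    have h2 := h.zero_right_pos
    have h3 := ih h.tail ht
    have g1 := Real.Gamma_pos_of_pos h1
    have g2 := Real.Gamma_pos_of_pos h2
    have g3 := Real.Gamma_pos_of_pos (add_pos h1 h2)
    positivity

/-- With the first interval `s` split off, the remaining integral scales like `(t - s)^N`, where `N`
sums `a_k + b_k - 1` over the later indices. The outer integral is then a Beta integral with
parameters `a_0` and `b_0 + N`. -/
theorem GDAdmissible.lintegral_gdWeight {n : ℕ} {a b : Fin n → ℝ} (h : GDAdmissible a b) {t : ℝ}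
    (ht : 0 < t) :
    ∫⁻ τ in timeSimplex n t, ENNReal.ofReal (gdWeight a b t τ) =
      ENNReal.ofReal (gdConst a b t)⁻¹ := by
  induction n generalizing t with
  | zero => simp [gdWeight, gdConst, timeSimplex_zero, volume_pi]
  | succ n ih =>
    have h1 := h.left_pos 0
    have h2 := h.zero_right_pos
    have hC := h.tail.gdConst_pos one_pos
    set N := ∑ k, (Fin.tail a k + Fin.tail b k - 1) with hN
    have hinner : ∀ s ∈ Set.Ioo 0 t, ∫⁻ τ in timeSimplex n (t - s),
        ENNReal.ofReal (gdWeight a b t (Fin.cons s τ)) = ENNReal.ofReal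
          ((gdConst (Fin.tail a) (Fin.tail b) 1)⁻¹ * (s ^ (a 0 - 1) * (t - s) ^ (b 0 + N - 1))) := by
      intro s hs
      have hts : 0 < t - s := sub_pos.2 hs.2
      have hs0 := hs.1
      simp only [gdWeight_cons]
      have hnn : 0 ≤ s ^ (a 0 - 1) * (t - s) ^ (b 0 - 1) := by positivity
      simp only [ENNReal.ofReal_mul hnn]
      rw [lintegral_const_mul _ (measurable_gdWeight _ _ _).ennreal_ofReal, ih h.tail hts,
        ← ENNReal.ofReal_mul hnn]
      congr 1
      have hscale : gdConst (Fin.tail a) (Fin.tail b) 1 =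
          (t - s) ^ N * gdConst (Fin.tail a) (Fin.tail b) (t - s) := by
        have := (Real.rpow_pos_of_pos hts N).ne'
        simp only [gdConst, ← hN]
        rw [Real.one_rpow]
        field_simp
      have hG := h.tail.gdConst_pos hts
      rw [hscale, show b 0 + N - 1 = b 0 - 1 + N by ring, Real.rpow_add hts]
      have := (Real.rpow_pos_of_pos hts N).ne'
      field_simp
    have hint := (integrableOn_rpow_mul_rpow h1 h2 ht).const_mul
      (gdConst (Fin.tail a) (Fin.tail b) 1)⁻¹
    rw [setLIntegral_timeSimplex_succ t (measurable_gdWeight _ _ _).ennreal_ofReal,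
      setLIntegral_congr_fun measurableSet_Ioo hinner, ← ofReal_integral_eq_lintegral_ofReal hint,
      integral_const_mul, integral_rpow_mul_rpow h1 h2 ht, gdConst_succ a b t one_pos, ← hN]
    · congr 1
      rw [show a 0 + b 0 - 1 + N = a 0 + (b 0 + N) - 1 by ring, Real.one_rpow]
      field_simp
    · refine (ae_restrict_iff' measurableSet_Ioo).2 (Filter.Eventually.of_forall fun s hs => ?_)
      have hts : 0 < t - s := sub_pos.2 hs.2
      have hs0 := hs.1
      simp only [Pi.zero_apply]
      positivity

theorem GDAdmissible.integrableOn_gdWeight {n : ℕ} {a b : Fin n → ℝ} (h : GDAdmissible a b)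
    {t : ℝ} (ht : 0 < t) : IntegrableOn (gdWeight a b t) (timeSimplex n t) := by
  refine (lintegral_ofReal_ne_top_iff_integrable (measurable_gdWeight _ _ _).aestronglyMeasurable
    ?_).1 ?_
  · exact (ae_restrict_iff' (measurableSet_timeSimplex n t)).2
      (Filter.Eventually.of_forall fun τ hτ => gdWeight_nonneg a b hτ)
  · rw [h.lintegral_gdWeight ht]
    exact ENNReal.ofReal_ne_top

theorem GDAdmissible.integral_gdWeight {n : ℕ} {a b : Fin n → ℝ} (h : GDAdmissible a b)
    {t : ℝ} (ht : 0 < t) : ∫ τ in timeSimplex n t, gdWeight a b t τ = (gdConst a b t)⁻¹ := by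
  rw [integral_eq_lintegral_of_nonneg_ae _ (measurable_gdWeight _ _ _).aestronglyMeasurable,
    h.lintegral_gdWeight ht, ENNReal.toReal_ofReal (inv_pos.2 (h.gdConst_pos ht)).le]
  exact (ae_restrict_iff' (measurableSet_timeSimplex n t)).2
    (Filter.Eventually.of_forall fun τ hτ => gdWeight_nonneg a b hτ)

theorem GDAdmissible.isProbabilityMeasure_gdMeasure {n : ℕ} {a b : Fin n → ℝ}
    (h : GDAdmissible a b) {t : ℝ} (ht : 0 < t) : IsProbabilityMeasure (gdMeasure a b t) := by
  have hC := h.gdConst_pos ht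
  refine ⟨?_⟩
  rw [gdMeasure, withDensity_apply _ MeasurableSet.univ, Measure.restrict_univ]
  have hd : ∀ τ, gdDensity a b t τ = gdConst a b t * gdWeight a b t τ := fun _ => rfl
  simp only [hd, ENNReal.ofReal_mul hC.le]
  rw [lintegral_const_mul _ (measurable_gdWeight a b t).ennreal_ofReal, h.lintegral_gdWeight ht,
    ← ENNReal.ofReal_mul hC.le, mul_inv_cancel₀ hC.ne', ENNReal.ofReal_one]

/-! ### The integral over the time intervals -/

/-- The right parameters `(1, …, 1, p)`, increased by `ε`. -/
def stepParam {n : ℕ} (p : ℝ) (ε : Fin n → ℕ) : Fin n → ℝ := fun k =>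
  (if (k : ℕ) + 1 = n then p else 1) + ε k

/-- The unnormalized density of the time intervals, multiplied by `f` at all `n + 1` intervals. -/
def stepIntegrand {n : ℕ} (p : ℝ) (ε : Fin n → ℕ) (f : ℝ → ℝ) (t : ℝ) (τ : Fin n → ℝ) : ℝ :=
  (∏ k, τ k ^ (p - 1) * f (τ k) * (t - ∑ j ∈ Finset.Iic k, τ j) ^ ε k) *
    ((t - ∑ k, τ k) ^ (p - 1) * f (t - ∑ k, τ k))

theorem stepIntegrand_cons {n : ℕ} (p : ℝ) (ε : Fin (n + 1) → ℕ) (f : ℝ → ℝ) (t s : ℝ)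
    (τ : Fin n → ℝ) :
    stepIntegrand p ε f t (Fin.cons s τ) = s ^ (p - 1) * f s * (t - s) ^ ε 0 *
      stepIntegrand p (Fin.tail ε) f (t - s) τ := by
  have h0 : Finset.Iic (0 : Fin (n + 1)) = {0} := by ext; simp
  simp only [stepIntegrand, Fin.prod_univ_succ, Fin.sum_univ_succ, Fin.sum_Iic_succ, Fin.cons_zero,
    Fin.cons_succ, h0, Finset.sum_singleton, sub_sub, Fin.tail, mul_assoc]

theorem measurable_stepIntegrand {n : ℕ} (p : ℝ) (ε : Fin n → ℕ) {f : ℝ → ℝ} (hf : Measurable f)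
    (t : ℝ) : Measurable (stepIntegrand p ε f t) := by
  unfold stepIntegrand
  fun_prop

theorem stepIntegrand_eq_mul_prod {n : ℕ} (p : ℝ) (ε : Fin n → ℕ) (f : ℝ → ℝ) (t : ℝ)
    (τ : Fin n → ℝ) :
    stepIntegrand p ε f t τ =
      stepIntegrand p ε (fun _ => 1) t τ * ∏ k, f (stepTimes t τ k) := by
  simp only [stepIntegrand, stepTimes, Fin.prod_univ_castSucc, Fin.snoc_castSucc, Fin.snoc_last,
    Finset.prod_mul_distrib, Finset.prod_const_one]
  ring

/-- The last entry of `b` supplies the power `p - 1` of the final interval `t - ∑ τ_k`, so all `n +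
1` intervals carry the same exponent. For `n = 0` there is no last entry to supply it, whence `1 ≤
n`. -/
theorem gdWeight_eq_stepIntegrand {n : ℕ} (hn : 1 ≤ n) (p : ℝ) (ε : Fin n → ℕ) {t : ℝ}
    {τ : Fin n → ℝ} (hτ : τ ∈ timeSimplex n t) :
    gdWeight (fun _ => p) (stepParam p ε) t τ = stepIntegrand p ε (fun _ => 1) t τ := by
  obtain ⟨n, rfl⟩ : ∃ m, n = m + 1 := ⟨n - 1, by omega⟩
  have hlast : Finset.Iic (Fin.last n) = Finset.univ := by ext i; simp [Fin.le_last]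
  have h1 : ∀ k : Fin n, (t - ∑ j ∈ Finset.Iic k.castSucc, τ j) ^
      (stepParam p ε k.castSucc - 1) = (t - ∑ j ∈ Finset.Iic k.castSucc, τ j) ^ ε k.castSucc := by
    intro k
    have hk : ¬ (k : ℕ) + 1 = n + 1 := by omega
    simp only [stepParam, Fin.val_castSucc, hk, if_false, add_sub_cancel_left, Real.rpow_natCast]
  have h2 : (t - ∑ j ∈ Finset.Iic (Fin.last n), τ j) ^ (stepParam p ε (Fin.last n) - 1) =
      (t - ∑ j ∈ Finset.Iic (Fin.last n), τ j) ^ ε (Fin.last n) *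
        (t - ∑ j ∈ Finset.Iic (Fin.last n), τ j) ^ (p - 1) := by
    have := sub_sum_Iic_pos hτ (Fin.last n)
    simp only [stepParam, Fin.val_last, if_true]
    rw [← Real.rpow_natCast, ← Real.rpow_add this]
    congr 1
    ring
  simp only [gdWeight, stepIntegrand, Fin.prod_univ_castSucc (n := n), h1, h2, mul_one]
  rw [hlast]
  ring

/-- The bound `1/2` makes every `a_j + b_j - 1` nonnegative, including the value `2p - 1` that the
last index can take. -/
theorem gdAdmissible_stepParam {n : ℕ} {p : ℝ} (hp : 1 / 2 ≤ p) (ε : Fin n → ℕ) :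
    GDAdmissible (fun _ => p) (stepParam p ε) where
  left_pos k := by linarith
  right_pos k := by
    have hb : ∀ j, min p 1 ≤ stepParam p ε j := fun j => by
      have : (0 : ℝ) ≤ ε j := (ε j).cast_nonneg
      simp only [stepParam]
      split_ifs
      · linarith [min_le_left p 1]
      · linarith [min_le_right p 1]
    have hmin : 1 / 2 ≤ min p 1 := le_min hp (by norm_num)
    have hb' : ∀ j, 0 ≤ p + stepParam p ε j - 1 := fun j => by linarith [hb j]
    have := Finset.sum_nonneg fun j (_ : j ∈ Finset.Ioi k) => hb' j
    linarith [hb k]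

theorem integrableOn_stepIntegrand_one {n : ℕ} {p : ℝ} (hp : 1 / 2 ≤ p) (ε : Fin n → ℕ) {t : ℝ}
    (ht : 0 < t) : IntegrableOn (stepIntegrand p ε (fun _ => 1) t) (timeSimplex n t) := by
  rcases Nat.eq_zero_or_pos n with rfl | hn
  · have h : stepIntegrand p ε (fun _ => 1) t = fun _ => t ^ (p - 1) := by
      ext; simp [stepIntegrand]
    rw [h, timeSimplex_zero, integrableOn_univ]
    have : IsFiniteMeasure (volume : Measure (Fin 0 → ℝ)) := ⟨by simp [volume_pi]⟩
    exact integrable_const _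
  · exact ((gdAdmissible_stepParam hp ε).integrableOn_gdWeight ht).congr_fun
      (fun τ hτ => gdWeight_eq_stepIntegrand hn p ε hτ) (measurableSet_timeSimplex n t)

theorem integrableOn_stepIntegrand {n : ℕ} {p : ℝ} (hp : 1 / 2 ≤ p) (ε : Fin n → ℕ) {f : ℝ → ℝ}
    (hf : Measurable f) (hf1 : ∀ x, |f x| ≤ 1) {t : ℝ} (ht : 0 < t) :
    IntegrableOn (stepIntegrand p ε f t) (timeSimplex n t) := by
  refine Integrable.mono (integrableOn_stepIntegrand_one hp ε ht)
    (measurable_stepIntegrand p ε hf t).aestronglyMeasurable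
    (Filter.Eventually.of_forall fun τ => ?_)
  rw [stepIntegrand_eq_mul_prod p ε f, norm_mul, norm_prod]
  exact mul_le_of_le_one_right (norm_nonneg _)
    (Finset.prod_le_one (fun _ _ => norm_nonneg _) fun _ _ => hf1 _)

/-- At these orders the function is a characteristic function. The bound lets the Dirichlet weight
dominate the step integrands, as Fubini requires. -/
theorem abs_normBessel_le_one {d : ℕ} (hd : 1 ≤ d) (x : ℝ) :
    |normBessel ((d : ℝ) / 2 - 1) x| ≤ 1 := by
  have := isProbabilityMeasure_uniformSphere hd
  have hx : normBessel ((d : ℝ) / 2 - 1) x = normBessel ((d : ℝ) / 2 - 1) |x| := by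
    simp only [normBessel, pow_mul, sq_abs]
  have h := integral_cexp_inner_uniformSphere hd (EuclideanSpace.single (⟨0, hd⟩ : Fin d) x)
  simp only [PiLp.norm_single, Real.norm_eq_abs] at h
  rw [hx, ← Real.norm_eq_abs, ← Complex.norm_real, ← h]
  refine (norm_integral_le_integral_norm _).trans ?_
  simp [Complex.norm_exp_ofReal_mul_I]

theorem measurable_normBessel {ν : ℝ} (hν : 0 ≤ ν) : Measurable (normBessel ν) :=
  measurable_of_tendsto_metrizable (fun n => (by fun_prop :
      Measurable fun x => ∑ k ∈ Finset.range n, besselCoeff ν k * x ^ (2 * k)))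
    (tendsto_pi_nhds.2 fun x => (summable_besselCoeff_mul hν x).hasSum.tendsto_sum_nat)

theorem besselOrder_sphere {d h : ℕ} (hh : h = 1 ∨ h = 2) :
    besselOrder h ((d : ℝ) / h - 1) = (d : ℝ) / 2 - 1 := by
  rcases hh with rfl | rfl
  · simp [besselOrder]; ring
  · simp [besselOrder]

/-- Induction by splitting off the first interval, one convolution step each time. `K` is chosen
before `l` and `t`; this allows the inner integral to be evaluated at time `t - s`, and `K` to be
found later from `l = 0`. -/
theorem exists_integral_stepIntegrand {d h : ℕ} (hd : 2 ≤ d) (hh : h = 1 ∨ h = 2) {p : ℝ}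
    (hp : 1 / 2 ≤ p) (hpd : besselOrder h p = (d : ℝ) / 2 - 1) (n : ℕ) (ε : Fin n → ℕ)
    (hε : ∑ k, ε k ≤ 1) :
    ∃ K : ℝ, ∀ l t : ℝ, 0 < t →
      ∫ τ in timeSimplex n t, stepIntegrand p ε (fun x => normBessel (besselOrder h p) (l * x)) t τ =
        K * t ^ ((n + 1) * p + (∑ k, ε k : ℕ) - 1) *
          normBessel (besselOrder h ((n + 1) * p)) (l * t) := by
  have hd' : (2 : ℝ) ≤ d := by exact_mod_cast hd
  have hν : 0 ≤ besselOrder h p := by rw [hpd]; linarith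
  induction n with
  | zero =>
    refine ⟨1, fun l t _ => ?_⟩
    simp [stepIntegrand, timeSimplex_zero, volume_pi, Measure.real]
  | succ n ih =>
    rw [Fin.sum_univ_succ] at hε ⊢
    obtain ⟨K, hK⟩ := ih (Fin.tail ε) (le_trans (Nat.le_add_left _ _) hε)
    have hq : 0 < ((n : ℝ) + 1) * p := by positivity
    have hνq : 0 ≤ besselOrder h ((n + 1) * p) := by
      refine hν.trans ?_
      have : p ≤ (n + 1) * p := by
        have : (0 : ℝ) ≤ n * p := by positivity
        linarith
      have h0 : (0 : ℝ) ≤ h := h.cast_nonneg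
      simp only [besselOrder]
      gcongr
    -- The power of `t - s` from `ε 0` merges with the one left by the inner integral; their sum is
    -- at most 1, the range covered by the convolution step.
    set e := ε 0 + ∑ k : Fin n, ε k.succ with he
    refine ⟨K * (Real.Gamma p * Real.Gamma ((n + 1) * p + e) /
      Real.Gamma (p + ((n + 1) * p + e))), fun l t ht => ?_⟩
    have hmeas : Measurable fun x => normBessel (besselOrder h p) (l * x) :=
      (measurable_normBessel hν).comp (by fun_prop)
    have hbound : ∀ x, |normBessel (besselOrder h p) (l * x)| ≤ 1 := fun x => by
      rw [hpd]; exact abs_normBessel_le_one (by omega) _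
    rw [setIntegral_timeSimplex_succ (integrableOn_stepIntegrand hp ε hmeas hbound ht)]
    have hinner : ∀ s ∈ Set.Ioo 0 t, ∫ τ in timeSimplex n (t - s),
        stepIntegrand p ε (fun x => normBessel (besselOrder h p) (l * x)) t (Fin.cons s τ) =
        K * ((s ^ (p - 1) * normBessel (besselOrder h p) (l * s)) *
          ((t - s) ^ ((n + 1) * p + e - 1) *
            normBessel (besselOrder h ((n + 1) * p)) (l * (t - s)))) := fun s hs => by
      have hts : 0 < t - s := sub_pos.2 hs.2
      simp only [stepIntegrand_cons]
      rw [integral_const_mul, hK l _ hts, he,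
        show ((n : ℝ) + 1) * p + ((ε 0 + ∑ k : Fin n, ε k.succ : ℕ) : ℝ) - 1 =
          (ε 0 : ℝ) + ((n + 1) * p + (∑ k, Fin.tail ε k : ℕ) - 1) by
            simp only [Fin.tail]; push_cast; ring,
        Real.rpow_add hts, Real.rpow_natCast]
      ring
    rw [setIntegral_congr_fun measurableSet_Ioo hinner, integral_const_mul,
      integral_normBessel_mul_normBessel hh (by positivity) hq hν hνq hε l ht]
    rw [show p + (((n : ℝ) + 1) * p + e) - 1 = ((n + 1 : ℕ) + 1) * p + e - 1 by push_cast; ring,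
      show p + ((n : ℝ) + 1) * p = ((n + 1 : ℕ) + 1) * p by push_cast; ring]
    ring

theorem integral_prod_normBessel_gdMeasure {d h n : ℕ} (hd : 2 ≤ d) (hn : 1 ≤ n)
    (hh : h = 1 ∨ h = 2) {p : ℝ}
    (hp : 1 / 2 ≤ p) (hpd : besselOrder h p = (d : ℝ) / 2 - 1) (ε : Fin n → ℕ)
    (hε : ∑ k, ε k ≤ 1) (l : ℝ) {t : ℝ} (ht : 0 < t) :
    ∫ τ, ∏ k, normBessel (besselOrder h p) (l * stepTimes t τ k)
        ∂gdMeasure (fun _ => p) (stepParam p ε) t =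
      normBessel (besselOrder h ((n + 1) * p)) (l * t) := by
  have hd' : (2 : ℝ) ≤ d := by exact_mod_cast hd
  have hν : 0 ≤ besselOrder h p := by rw [hpd]; linarith
  have hνq : 0 ≤ besselOrder h ((n + 1) * p) := by
    refine hν.trans ?_
    have : p ≤ (n + 1) * p := by
      have : (0 : ℝ) ≤ n * p := by positivity
      linarith
    have h0 : (0 : ℝ) ≤ h := h.cast_nonneg
    simp only [besselOrder]
    gcongr
  have hadm := gdAdmissible_stepParam hp ε
  set C := gdConst (fun _ => p) (stepParam p ε) t with hC
  have hCpos : 0 < C := hadm.gdConst_pos ht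
  obtain ⟨K, hK⟩ := exists_integral_stepIntegrand hd hh hp hpd n ε hε
  -- At `l = 0` all Bessel factors equal 1, and the integral is the total mass of the unnormalized
  -- density.
  have hnorm : C * (K * t ^ ((n + 1) * p + (∑ k, ε k : ℕ) - 1)) = 1 := by
    have h0 := hK 0 t ht
    simp only [zero_mul, normBessel_zero hν, normBessel_zero hνq, mul_one] at h0
    rw [← h0, ← setIntegral_congr_fun (measurableSet_timeSimplex n t)
      (fun τ hτ => gdWeight_eq_stepIntegrand hn p ε hτ), hadm.integral_gdWeight ht,
      mul_inv_cancel₀ hCpos.ne']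
  have hdens : Measurable (gdDensity (fun _ => p) (stepParam p ε) t) :=
    (measurable_gdWeight (fun _ => p) (stepParam p ε) t).const_mul C
  rw [gdMeasure, integral_withDensity_eq_integral_toReal_smul hdens.ennreal_ofReal
    (Filter.Eventually.of_forall fun _ => ENNReal.ofReal_lt_top)]
  have hcongr : ∀ τ ∈ timeSimplex n t,
      (ENNReal.ofReal (gdDensity (fun _ => p) (stepParam p ε) t τ)).toReal •
        ∏ k, normBessel (besselOrder h p) (l * stepTimes t τ k) =
      C * stepIntegrand p ε (fun x => normBessel (besselOrder h p) (l * x)) t τ := fun τ hτ => by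
    have hg : gdDensity (fun _ => p) (stepParam p ε) t τ =
        C * gdWeight (fun _ => p) (stepParam p ε) t τ := rfl
    rw [hg, ENNReal.toReal_ofReal (mul_nonneg hCpos.le (gdWeight_nonneg _ _ hτ)),
      gdWeight_eq_stepIntegrand hn p ε hτ,
      stepIntegrand_eq_mul_prod p ε (fun x => normBessel (besselOrder h p) (l * x)), smul_eq_mul]
    ring
  rw [setIntegral_congr_fun (measurableSet_timeSimplex n t) hcongr, integral_const_mul, hK l t ht,
    ← mul_assoc, hnorm, one_mul]

/-! ### The characteristic function of the walk -/

theorem measurable_stepTimes {n : ℕ} (t : ℝ) (k : Fin (n + 1)) :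
    Measurable fun τ : Fin n → ℝ => stepTimes t τ k := by
  cases k using Fin.lastCases <;> simp only [stepTimes, Fin.snoc_last, Fin.snoc_castSucc] <;> fun_prop

theorem measurable_walkPosition {d n : ℕ} (c t : ℝ) :
    Measurable (walkPosition (d := d) (n := n) c t) := by
  unfold walkPosition
  refine Measurable.const_smul (Finset.measurable_sum _ fun k _ => ?_) c
  exact ((measurable_stepTimes t k).comp measurable_fst).smul
    (measurable_subtype_coe.comp ((measurable_pi_apply k).comp measurable_snd))

theorem isProbabilityMeasure_walkMeasure {d n : ℕ} (hd : 1 ≤ d) {a b : Fin n → ℝ}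
    (h : GDAdmissible a b) {t : ℝ} (ht : 0 < t) : IsProbabilityMeasure (walkMeasure d a b t) := by
  have := isProbabilityMeasure_uniformSphere hd
  have := h.isProbabilityMeasure_gdMeasure ht
  unfold walkMeasure
  infer_instance

/-- Conditioning on the times: independence of the directions factors the inner integral into sphere
characteristic functions at `c τ_k α`. -/
theorem charFun_walkPosition {d n : ℕ} (hd : 1 ≤ d) {a b : Fin n → ℝ} (h : GDAdmissible a b)
    (c : ℝ) {t : ℝ} (ht : 0 < t) (α : EuclideanSpace ℝ (Fin d)) :
    charFun ((walkMeasure d a b t).map (walkPosition c t)) α =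
      ((∫ τ, ∏ k, normBessel ((d : ℝ) / 2 - 1) (c * ‖α‖ * stepTimes t τ k) ∂gdMeasure a b t : ℝ) : ℂ) := by
  have := isProbabilityMeasure_uniformSphere hd
  have := h.isProbabilityMeasure_gdMeasure ht
  have := isProbabilityMeasure_walkMeasure hd h ht
  have hmeas := measurable_walkPosition (d := d) (n := n) c t
  have hcont : Continuous fun x : EuclideanSpace ℝ (Fin d) =>
      Complex.exp ((inner ℝ x α : ℝ) * Complex.I) := by fun_prop
  have hint : Integrable (fun ω : WalkSpace d n =>
      Complex.exp ((inner ℝ (walkPosition c t ω) α : ℝ) * Complex.I)) (walkMeasure d a b t) :=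
    Integrable.of_bound (hcont.measurable.comp hmeas).aestronglyMeasurable 1
      (Filter.Eventually.of_forall fun ω => (Complex.norm_exp_ofReal_mul_I _).le)
  rw [charFun_apply, integral_map hmeas.aemeasurable hcont.aestronglyMeasurable]
  unfold walkMeasure at hint ⊢
  rw [integral_prod _ hint, ← integral_complex_ofReal]
  refine integral_congr_ae (Filter.Eventually.of_forall fun τ => ?_)
  have hprod : ∀ v : Fin (n + 1) → Metric.sphere (0 : EuclideanSpace ℝ (Fin d)) 1,
      Complex.exp ((inner ℝ (walkPosition c t (τ, v)) α : ℝ) * Complex.I) =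
        ∏ k, Complex.exp ((inner ℝ (v k : EuclideanSpace ℝ (Fin d))
          ((c * stepTimes t τ k) • α) : ℝ) * Complex.I) := fun v => by
    rw [← Complex.exp_sum, ← Finset.sum_mul, ← Complex.ofReal_sum]
    simp only [walkPosition, inner_smul_left, inner_smul_right, sum_inner, Finset.mul_sum,
      RCLike.conj_to_real, mul_assoc]
  simp only [hprod]
  rw [integral_fintype_prod_eq_prod (fun (k : Fin (n + 1))
    (v : Metric.sphere (0 : EuclideanSpace ℝ (Fin d)) 1) =>
    Complex.exp ((inner ℝ (v : EuclideanSpace ℝ (Fin d))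
      ((c * stepTimes t τ k) • α) : ℝ) * Complex.I)), Complex.ofReal_prod]
  refine Finset.prod_congr rfl fun k _ => ?_
  rw [integral_cexp_inner_uniformSphere hd, norm_smul, Real.norm_eq_abs]
  congr 1
  -- The series contains only even powers, so the absolute value of `c * stepTimes t τ k` can be
  -- dropped.
  simp only [normBessel, pow_mul, mul_pow, sq_abs]
  congr 1
  ext k
  ring

/-- For `h = 2` and `d = 2` the parameter would be 0, outside the Dirichlet range; this is where `3
≤ d` is needed. -/
theorem half_le_param {d h : ℕ} (hd : 2 ≤ d) (hh : h = 1 ∨ h = 2) (hdh : h = 2 → 3 ≤ d) :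
    1 / 2 ≤ (d : ℝ) / h - 1 := by
  rcases hh with rfl | rfl
  · have : (2 : ℝ) ≤ d := by exact_mod_cast hd
    norm_num
    linarith
  · have : (3 : ℝ) ≤ d := by exact_mod_cast hdh rfl
    norm_num
    linarith

theorem charFun_walkPosition_stepParam {d h n : ℕ} (hd : 2 ≤ d) (hn : 1 ≤ n)
    (hh : h = 1 ∨ h = 2) (hdh : h = 2 → 3 ≤ d) (ε : Fin n → ℕ) (hε : ∑ k, ε k ≤ 1) (c : ℝ) {t : ℝ}
    (ht : 0 < t) (α : EuclideanSpace ℝ (Fin d)) :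
    charFun ((walkMeasure d (paramA d n h) (stepParam ((d : ℝ) / h - 1) ε) t).map
      (walkPosition c t)) α =
      normBessel (besselOrder h ((n + 1) * ((d : ℝ) / h - 1))) (c * t * ‖α‖) := by
  have hp := half_le_param hd hh hdh
  have hA : paramA d n h = fun _ => (d : ℝ) / h - 1 := rfl
  rw [hA, charFun_walkPosition (by omega) (gdAdmissible_stepParam hp ε) c ht α,
    ← besselOrder_sphere hh,
    integral_prod_normBessel_gdMeasure hd hn hh hp (besselOrder_sphere hh) ε hε _ ht]
  congr 2
  ring

theorem sum_ite_one_le_one {n : ℕ} (P : Fin n → Prop) [DecidablePred P]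
    (hP : ∀ i j, P i → P j → i = j) : ∑ k, (if P k then 1 else 0) ≤ 1 := by
  rw [← Finset.card_filter, Finset.card_le_one]
  intro i hi j hj
  exact hP i j (by simpa using hi) (by simpa using hj)

theorem exists_paramBY_eq_stepParam {d n h i : ℕ} (hi : i = 0 ∨ i = 1) :
    ∃ ε : Fin n → ℕ, ∑ k, ε k ≤ 1 ∧ paramBY d n h i = stepParam ((d : ℝ) / h - 1) ε := by
  -- With `p = d/h - 1`, the last entry `d/h - i` is `p + 1` for `i = 0` and `p` for `i = 1`.
  refine ⟨fun k => if (k : ℕ) + 1 = n ∧ i = 0 then 1 else 0,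
    sum_ite_one_le_one _ fun k l hk hl => Fin.ext (by omega), funext fun k => ?_⟩
  simp only [paramBY, stepParam]
  rcases hi with rfl | rfl <;> by_cases hk : (k : ℕ) + 1 = n <;> simp [hk]

theorem exists_paramBZ_eq_stepParam (d n h j : ℕ) :
    ∃ ε : Fin n → ℕ, ∑ k, ε k ≤ 1 ∧ paramBZ d n h j = stepParam ((d : ℝ) / h - 1) ε := by
  -- For `j ≥ n` this `ε` vanishes identically; in particular `j = n` leaves the last entry at `p`.
  refine ⟨fun k => if (k : ℕ) + 1 ≠ n ∧ (k : ℕ) + 1 = j then 1 else 0,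
    sum_ite_one_le_one _ fun k l hk hl => Fin.ext (by omega), funext fun k => ?_⟩
  simp only [paramBZ, stepParam]
  by_cases hk : (k : ℕ) + 1 = n
  · simp [hk]
  · by_cases hj : (k : ℕ) + 1 = j
    · rw [if_neg hk, if_pos hj, if_neg hk, if_pos ⟨hk, hj⟩]
      norm_num
    · rw [if_neg hk, if_neg hj, if_neg hk, if_neg fun h => hj h.2]
      simp

theorem normBessel_eq_besselCF1 {d n : ℕ} (hd : 2 ≤ d) {c t : ℝ} (hc : 0 < c) (ht : 0 < t)
    (α : EuclideanSpace ℝ (Fin d)) :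
    normBessel (besselOrder 1 ((n + 1) * ((d : ℝ) / (1 : ℕ) - 1))) (c * t * ‖α‖) =
      besselCF1 d n c t α := by
  have hd' : (2 : ℝ) ≤ d := by exact_mod_cast hd
  have hord : besselOrder 1 ((n + 1) * ((d : ℝ) / (1 : ℕ) - 1)) =
      ((n : ℝ) + 1) / 2 * ((d : ℝ) - 1) - 1 / 2 := by
    simp only [besselOrder, Nat.cast_one, div_one]
    ring
  rw [besselCF1, hord]
  split_ifs with hα
  · have h0 : 0 ≤ (n : ℝ) * (d - 1) := mul_nonneg n.cast_nonneg (by linarith)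
    rw [hα, norm_zero, mul_zero, normBessel_zero (by linarith)]
  · have hx : 0 < c * t * ‖α‖ := mul_pos (mul_pos hc ht) (norm_pos_iff.2 hα)
    rw [← normBessel_eq_besselJ _ hx]
    rw [show ((n : ℝ) + 1) / 2 * ((d : ℝ) - 1) + 1 / 2 =
      ((n : ℝ) + 1) / 2 * ((d : ℝ) - 1) - 1 / 2 + 1 by ring]

theorem normBessel_eq_besselCF2 {d n : ℕ} (hd : 2 ≤ d) {c t : ℝ} (hc : 0 < c) (ht : 0 < t)
    (α : EuclideanSpace ℝ (Fin d)) :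
    normBessel (besselOrder 2 ((n + 1) * ((d : ℝ) / (2 : ℕ) - 1))) (c * t * ‖α‖) =
      besselCF2 d n c t α := by
  have hd' : (2 : ℝ) ≤ d := by exact_mod_cast hd
  have hord : besselOrder 2 ((n + 1) * ((d : ℝ) / (2 : ℕ) - 1)) =
      ((n : ℝ) + 1) * ((d : ℝ) / 2 - 1) := by
    simp only [besselOrder, Nat.cast_ofNat]
    ring
  rw [besselCF2, hord]
  split_ifs with hα
  · rw [hα, norm_zero, mul_zero, normBessel_zero (mul_nonneg (by positivity) (by linarith))]
  · rw [← normBessel_eq_besselJ _ (mul_pos (mul_pos hc ht) (norm_pos_iff.2 hα))]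

theorem identDistrib_of_charFun_eq {Ω E : Type*} [MeasurableSpace Ω]
    [NormedAddCommGroup E] [InnerProductSpace ℝ E] [CompleteSpace E] [SecondCountableTopology E]
    [MeasurableSpace E] [BorelSpace E] {X : Ω → E} (hX : Measurable X) {μ ν : Measure Ω}
    [IsFiniteMeasure μ] [IsFiniteMeasure ν] (h : ∀ α, charFun (μ.map X) α = charFun (ν.map X) α) :
    IdentDistrib X X μ ν :=
  ⟨hX.aemeasurable, hX.aemeasurable, Measure.ext_of_charFun (funext h)⟩

end

theorem mainTheorem4 (d n h j : ℕ) (hd : 2 ≤ d) (hn : 1 ≤ n) (hh : h = 1 ∨ h = 2)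
    (hdh : h = 2 → 3 ≤ d) (hj : 1 ≤ j) (c t : ℝ) (hc : 0 < c) (ht : 0 < t) :
    IdentDistrib (walkPosition (d := d) (n := n) c t) (walkPosition (d := d) (n := n) c t)
      (measureY d n h 0 t) (measureY d n h 1 t) ∧
    (∀ i : ℕ, i = 0 ∨ i = 1 →
      IdentDistrib (walkPosition (d := d) (n := n) c t) (walkPosition (d := d) (n := n) c t)
        (measureY d n h i t) (measureZ d n h j t)) ∧
    (h = 1 → ∀ α : EuclideanSpace ℝ (Fin d),
      (∀ i : ℕ, i = 0 ∨ i = 1 →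
        charFun ((measureY d n h i t).map (walkPosition c t)) α = besselCF1 d n c t α) ∧
      charFun ((measureZ d n h j t).map (walkPosition c t)) α = besselCF1 d n c t α) ∧
    (h = 2 → ∀ α : EuclideanSpace ℝ (Fin d),
      (∀ i : ℕ, i = 0 ∨ i = 1 →
        charFun ((measureY d n h i t).map (walkPosition c t)) α = besselCF2 d n c t α) ∧
      charFun ((measureZ d n h j t).map (walkPosition c t)) α = besselCF2 d n c t α) := by

  have hY : ∀ i : ℕ, i = 0 ∨ i = 1 → IsProbabilityMeasure (measureY d n h i t) ∧
      ∀ α, charFun ((measureY d n h i t).map (walkPosition c t)) α =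
        normBessel (besselOrder h ((n + 1) * ((d : ℝ) / h - 1))) (c * t * ‖α‖) := fun i hi => by
    obtain ⟨ε, hε, hb⟩ := exists_paramBY_eq_stepParam (d := d) (n := n) (h := h) hi
    rw [measureY, hb]
    exact ⟨isProbabilityMeasure_walkMeasure (by omega)
      (gdAdmissible_stepParam (half_le_param hd hh hdh) ε) ht,
      charFun_walkPosition_stepParam hd hn hh hdh ε hε c ht⟩
  have hZ : IsProbabilityMeasure (measureZ d n h j t) ∧
      ∀ α, charFun ((measureZ d n h j t).map (walkPosition c t)) α =
        normBessel (besselOrder h ((n + 1) * ((d : ℝ) / h - 1))) (c * t * ‖α‖) := by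
    obtain ⟨ε, hε, hb⟩ := exists_paramBZ_eq_stepParam d n h j
    rw [measureZ, hb]
    exact ⟨isProbabilityMeasure_walkMeasure (by omega)
      (gdAdmissible_stepParam (half_le_param hd hh hdh) ε) ht,
      charFun_walkPosition_stepParam hd hn hh hdh ε hε c ht⟩
  have hmeas := measurable_walkPosition (d := d) (n := n) c t
  have := hZ.1
  refine ⟨?_, fun i hi => ?_, ?_, ?_⟩
  · have := (hY 0 (.inl rfl)).1
    have := (hY 1 (.inr rfl)).1
    exact identDistrib_of_charFun_eq hmeas fun α => by
      rw [(hY 0 (.inl rfl)).2, (hY 1 (.inr rfl)).2]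
  · have := (hY i hi).1
    exact identDistrib_of_charFun_eq hmeas fun α => by rw [(hY i hi).2, hZ.2]
  · rintro rfl α
    rw [← normBessel_eq_besselCF1 hd hc ht]
    exact ⟨fun i hi => (hY i hi).2 α, hZ.2 α⟩
  · rintro rfl α
    rw [← normBessel_eq_besselCF2 hd hc ht]
    exact ⟨fun i hi => (hY i hi).2 α, hZ.2 α⟩
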